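/- Let $n\ge 1$. Let $U(n,1)$ be the subgroup of $GL_{n+1}(\mathbb C)$ preserving the Hermitian form $\langle z,w\rangle=z_1\overline{w_1}+\dots+z_n\overline{w_n}-z_{n+1}\overline{w_{n+1}}$, let $SU(n,1)\subset U(n,1)$ be the subgroup of elements of determinant one, and let $G=PU(n,1)$ be the quotient of $U(n,1)$ by its center. An element of $G$ is *elliptic* if it fixes a point of complex hyperbolic space, i.e. if its lifts to $U(n,1)$ have an eigenvector $z$ with $\langle z,z\rangle<0$. Put $$\mathcal T(G)=\{(\alpha_1,\dots,\alpha_n)\in[0,2\pi)^n : \alpha_1\ge\dots\ge\alpha_n\}.$$ For an elliptic $g\in G$, its *angles* are the unique $\alpha\in\mathcal T(G)$ such that some lift of $g$ to $U(n,1)$ is conjugate in $U(n,1)$ to $\mathrm{diag}(e^{i\alpha_1},\dots,e^{i\alpha_n},1)$; the *standard lift* $\tilde g$ of $g$ is the unique lift of $g$ to $SU(n,1)$ that is conjugate in $SU(n,1)$ to $$e^{-i(\alpha_1+\dots+\alpha_n)/(n+1)}\,\mathrm{diag}(e^{i\alpha_1},\dots,e^{i\alpha_n},1).$$ Let $\Gamma=\langle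 a,b,c\mid abc=1\rangle$. For $u\in\mathbb C$ with $u^{n+1}=1$, let $\mathrm{Hom}_{\mathrm{ell}}(\Gamma,G)_u$ be the set of homomorphisms $\rho:\Gamma\to G$ such that $\rho(a),\rho(b),\rho(c)$ are elliptic and $\widetilde{\rho(a)}\,\widetilde{\rho(b)}\,\widetilde{\rho(c)}=u\,\mathrm{Id}$. Call $\rho$ *reducible* if the lifts of $\rho(a),\rho(b),\rho(c)$ to $U(n,1)$ have a common invariant subspace of $\mathbb C^{n+1}$ other than $0$ and $\mathbb C^{n+1}$. Let $\mathcal P(G)_u\subset\mathcal T(G)^3$ be the set of triples of angles of $(\rho(a),\rho(b),\rho(c))$ for $\rho\in \mathrm{Hom}_{\mathrm{ell}}(\Gamma,G)_u$, and let $\mathcal P(G)_u^{\mathrm{red}}$ be the set of those that come from reducible $\rho\in \mathrm{Hom}_{\mathrm{ell}}(\Gamma,G)_u$. Finally, let $\mathcal T^*(G)=\{\alpha\in\mathcal T(G):\alpha_n>0\}$, which contains the interior of $\mathcal T(G)$. **Theorem.** Let $u$ be an $(n+1)$-th root of unity and let $C$ be a $u$-cell, i.e. a connected component of $\mathcal T^*(G)^3\setminus\mathcal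 P(G)_u^{\mathrm{red}}$. Then either $C\subset\mathcal P(G)_u$ ("full") or $C\cap\mathcal P(G)_u=\varnothing$ ("empty"). -/

import Mathlib

open scoped Matrix

noncomputable section

namespace EllipticHorn

/-- The vector space `ℂ^{n+1}`; the last coordinate is the one indexed by `Sum.inr ()`. -/
abbrev Vec (n : ℕ) : Type := Fin n ⊕ Unit → ℂ

/-- The Hermitian form `z₁ w̄₁ + ⋯ + zₙ w̄ₙ - zₙ₊₁ w̄ₙ₊₁` of signature `(n, 1)`. -/
def hermForm (n : ℕ) (z w : Vec n) : ℂ :=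
  ∑ k : Fin n, z (Sum.inl k) * star (w (Sum.inl k)) - z (Sum.inr ()) * star (w (Sum.inr ()))

/-- `U(n,1)`: the subgroup of `GL_{n+1}(ℂ)` preserving the Hermitian form. -/
def U (n : ℕ) : Subgroup (GL (Fin n ⊕ Unit) ℂ) where
  carrier := {A | ∀ z w : Vec n,
    hermForm n ((A : Matrix (Fin n ⊕ Unit) (Fin n ⊕ Unit) ℂ) *ᵥ z)
      ((A : Matrix (Fin n ⊕ Unit) (Fin n ⊕ Unit) ℂ) *ᵥ w) = hermForm n z w}
  mul_mem' := by
    intro A B hA hB z w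
    rw [Units.val_mul, ← Matrix.mulVec_mulVec, ← Matrix.mulVec_mulVec, hA, hB]
  one_mem' := by
    intro z w
    simp
  inv_mem' := by
    intro A hA z w
    rw [← hA, Matrix.mulVec_mulVec, Matrix.mulVec_mulVec, Units.mul_inv, Matrix.one_mulVec,
      Matrix.one_mulVec]

/-- The matrix of an element of `U(n,1)`. -/
def mat {n : ℕ} (A : U n) : Matrix (Fin n ⊕ Unit) (Fin n ⊕ Unit) ℂ :=
  ((A : GL (Fin n ⊕ Unit) ℂ) : Matrix (Fin n ⊕ Unit) (Fin n ⊕ Unit) ℂ)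

/-- `SU(n,1)`, as a subgroup of `U(n,1)`. -/
def SU (n : ℕ) : Subgroup (U n) where
  carrier := {A | (mat A).det = 1}
  mul_mem' := by
    intro A B hA hB
    simp only [Set.mem_ofPred_eq, mat] at *
    simp [hA, hB]
  one_mem' := by
    simp [mat]
  inv_mem' := by
    intro A hA
    simp only [Set.mem_ofPred_eq, mat] at *
    simp [hA]

/-- `PU(n,1)`: the quotient of `U(n,1)` by its center. -/
abbrev PU (n : ℕ) : Type := U n ⧸ Subgroup.center (U n)

/-- `A ∈ U(n,1)` is a lift of `g ∈ PU(n,1)`. -/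
def IsLift {n : ℕ} (A : U n) (g : PU n) : Prop :=
  (QuotientGroup.mk A : PU n) = g

/-- `g` is elliptic: it fixes a point of complex hyperbolic space `ℙ(V⁻)`, that is, some lift
of `g` preserves a line spanned by a vector of negative type. -/
def IsElliptic {n : ℕ} (g : PU n) : Prop :=
  ∃ A : U n, IsLift A g ∧
    ∃ z : Vec n, (hermForm n z z).re < 0 ∧ ∃ c : ℂ, mat A *ᵥ z = c • z

/-- The space `𝒯(G)` of ordered angles `2π > α₁ ≥ ⋯ ≥ αₙ ≥ 0`, parametrizing the elliptic
conjugacy classes of `PU(n,1)`. -/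
def angleSpace (n : ℕ) : Set (Fin n → ℝ) :=
  {α | (∀ k, 0 ≤ α k ∧ α k < 2 * Real.pi) ∧ Antitone α}

/-- The matrix `E(α₁, …, αₙ) = diag(e^{iα₁}, …, e^{iαₙ}, 1)`. -/
def angleMatrix {n : ℕ} (α : Fin n → ℝ) : Matrix (Fin n ⊕ Unit) (Fin n ⊕ Unit) ℂ :=
  Matrix.diagonal (Sum.elim (fun k => Complex.exp (Complex.I * (α k : ℂ))) (fun _ => 1))

/-- `α` is the point of `𝒯(G)` attached to the conjugacy class of the elliptic element `g`:
some lift `A` of `g` is conjugate in `U(n,1)` to `E(α₁, …, αₙ)`. -/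
def HasAngles {n : ℕ} (g : PU n) (α : Fin n → ℝ) : Prop :=
  α ∈ angleSpace n ∧
    ∃ A : U n, IsLift A g ∧ ∃ Q : U n, mat A * mat Q = mat Q * angleMatrix α

/-- The diagonal matrix of determinant one whose conjugacy class is the standard lift to
`SU(n,1)` of the elliptic class with angles `α`. -/
def standardMatrix {n : ℕ} (α : Fin n → ℝ) : Matrix (Fin n ⊕ Unit) (Fin n ⊕ Unit) ℂ :=
  Matrix.diagonal (Sum.elim
    (fun k => Complex.exp (Complex.I *
      (((n * α k - ∑ j ∈ Finset.univ.erase k, α j) / (n + 1) : ℝ) : ℂ)))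
    (fun _ => Complex.exp (-Complex.I * (((∑ j, α j) / (n + 1) : ℝ) : ℂ))))

/-- `A ∈ SU(n,1)` is the standard lift of the elliptic element `g`: it is a lift of `g` and
is conjugate in `SU(n,1)` to the standard matrix of the angles of `g`. -/
def IsStandardLift {n : ℕ} (g : PU n) (A : SU n) : Prop :=
  IsLift (A : U n) g ∧ ∃ α : Fin n → ℝ, HasAngles g α ∧
    ∃ Q : SU n, mat (A : U n) * mat (Q : U n) = mat (Q : U n) * standardMatrix α

/-- The group `Γ = ⟨a, b, c | abc = 1⟩`; the generators `a, b, c` are numbered `0, 1, 2`. -/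
abbrev Gam : Type :=
  PresentedGroup ({FreeGroup.of 0 * FreeGroup.of 1 * FreeGroup.of 2} : Set (FreeGroup (Fin 3)))

/-- The generators `a, b, c` of `Γ`. -/
def gen (i : Fin 3) : Gam := PresentedGroup.of i

/-- `Hom_ell(Γ, G)`: the representations sending `a, b, c` to elliptic elements. -/
def HomEll (n : ℕ) : Set (Gam →* PU n) :=
  {ρ | ∀ i, IsElliptic (ρ (gen i))}

/-- `ρ` is reducible: the lifts of `ρ(a), ρ(b), ρ(c)` have a common invariant subspace other
than `0` and `ℂ^{n+1}`. -/
def IsReducible {n : ℕ} (ρ : Gam →* PU n) : Prop :=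
  ∃ W : Submodule ℂ (Vec n), W ≠ ⊥ ∧ W ≠ ⊤ ∧
    ∀ i, ∀ A : U n, IsLift A (ρ (gen i)) → ∀ v ∈ W, mat A *ᵥ v ∈ W

/-- `Hom_ell(Γ, G)_u`: the product of the standard lifts of `ρ(a), ρ(b), ρ(c)` is `u Id`. -/
def HomEllLevel (n : ℕ) (u : ℂ) : Set (Gam →* PU n) :=
  {ρ | ρ ∈ HomEll n ∧ ∃ A : Fin 3 → SU n, (∀ i, IsStandardLift (ρ (gen i)) (A i)) ∧
    mat (A 0 : U n) * mat (A 1 : U n) * mat (A 2 : U n) =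
      u • (1 : Matrix (Fin n ⊕ Unit) (Fin n ⊕ Unit) ℂ)}

/-- `𝒫(G)_u`, the set of triples of angles of the representations in `Hom_ell(Γ, G)_u`. -/
def solutionSet (n : ℕ) (u : ℂ) : Set (Fin 3 → Fin n → ℝ) :=
  {τ | ∃ ρ ∈ HomEllLevel n u, ∀ i, HasAngles (ρ (gen i)) (τ i)}

/-- `𝒫(G)^red_u`, the set of triples of angles of the reducible representations in
`Hom_ell(Γ, G)_u`. -/
def reducibleSet (n : ℕ) (u : ℂ) : Set (Fin 3 → Fin n → ℝ) :=
  {τ | ∃ ρ ∈ HomEllLevel n u, IsReducible ρ ∧ ∀ i, HasAngles (ρ (gen i)) (τ i)}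

/-- The triples in `𝒯(G)³` all of whose angles are nonzero. This set contains the interior of
`𝒯(G)³`; it consists of the triples of elliptic classes whose eigenvalue of negative type is
simple. -/
def nonzeroAngleTriples (n : ℕ) : Set (Fin 3 → Fin n → ℝ) :=
  {τ | ∀ i, τ i ∈ angleSpace n ∧ ∀ k, τ i k ≠ 0}

/-- `C` is a `u`-cell: a connected component of the complement of `𝒫(G)^red_u` in the space of
triples with nonzero angles. -/
def IsCell (n : ℕ) (u : ℂ) (C : Set (Fin 3 → Fin n → ℝ)) : Prop :=
  ∃ τ ∈ nonzeroAngleTriples n \ reducibleSet n u,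
    C = connectedComponentIn (nonzeroAngleTriples n \ reducibleSet n u) τ

end EllipticHorn

end

/-!
The solution set is shown to be both closed and open relative to a cell, so that connectedness of
the cell forces it to be contained in the solution set or disjoint from it. Everything is phrased
in terms of matrices: by uniqueness of the angles (`HasAngles.unique`) and the description of the
center of `U(n,1)` (`center_eq_smul`), a triple `τ` of angles lies in the solution set if and only
if there are matrices `Q₀, Q₁, Q₂` preserving the Hermitian form such that the product of the
conjugates `Qᵢ S(τᵢ) Qᵢ⁻¹` of the standard matrices is `u` (`mem_solutionSet_iff`).

*Closedness* (`mem_solutionSet_of_mem_closure`) holds at all triples with nonzero angles. After a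
simultaneous conjugation `Q₀ = 1`. Since `ABC = u`, the traces of `AB` and of `CA` are those of
unimodular multiples of `C⁻¹` and `B⁻¹`, hence bounded by `n + 1`. If `Q₁` (or `Q₂`) were unbounded,
a limit `N` of `Q / ‖Q‖` would satisfy `N* N = 0 = N N*` for the adjoint of the form, so that
`N = v w*` with null vectors `v, w`, and the rescaled traces would converge to
`⟨S(β)w, w⟩ ⟨S(α)v, v⟩`. Both factors are nonzero, because `e^{iα_k} - 1` has negative real part
for all `k`; but the limit has to vanish. So the conjugating matrices converge along ultrafilters.

*Openness* (`Solves.eventually_exists`) holds at all irreducible solutions. With fixed angles, the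
derivative of the product under conjugation of the three factors is onto the Lie algebra of
`SU(n,1)`: by duality with respect to the trace form, its cokernel consists of traceless matrices
commuting with all three factors, which vanish by Schur's lemma (`infinitesimalMap_surjective`). The
angles enter as parameters, so the local surjectivity theorem for strictly differentiable maps
solves the equation for all nearby angles, also across the walls where angles coincide. Manifold
charts are avoided by mapping a pseudo-unitary matrix `g` to its skew-adjoint part `g - g*`: if this
vanishes and `g` is close to `1`, then `g = 1`. The missing scalar direction is supplied by an
additional rotation `e^{is}`, which the determinant shows to be trivial.
-/

namespace EllipticHorn

/-! ### Matrices preserving the Hermitian form -/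

/-- The square matrices of size `n + 1`, with the index type of `Vec n`. -/
abbrev Mat (n : ℕ) : Type := Matrix (Fin n ⊕ Unit) (Fin n ⊕ Unit) ℂ

/-- The signs `1, …, 1, -1` of the Hermitian form. -/
def sgn (n : ℕ) : Fin n ⊕ Unit → ℂ := Sum.elim (fun _ => 1) (fun _ => -1)

/-- The Gram matrix of the Hermitian form. -/
def gram (n : ℕ) : Mat n := Matrix.diagonal (sgn n)

/-- The adjoint of a matrix with respect to the Hermitian form. -/
def adj {n : ℕ} (X : Mat n) : Mat n := gram n * Xᴴ * gram n

variable {n : ℕ}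

@[simp] lemma sgn_mul_self (i : Fin n ⊕ Unit) : sgn n i * sgn n i = 1 := by
  rcases i with i | i <;> simp [sgn]

lemma sgn_ne_zero (i : Fin n ⊕ Unit) : sgn n i ≠ 0 := fun h => by
  simpa [h] using sgn_mul_self i

@[simp] lemma star_sgn (i : Fin n ⊕ Unit) : star (sgn n i) = sgn n i := by
  rcases i with i | i <;> simp [sgn]

@[simp] lemma gram_mul_gram : gram n * gram n = 1 := by
  simp [gram]

@[simp] lemma conjTranspose_gram : (gram n)ᴴ = gram n := by
  simp only [gram, Matrix.diagonal_conjTranspose]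
  congr 1
  funext i
  exact star_sgn i

lemma adj_apply (X : Mat n) (i j : Fin n ⊕ Unit) :
    adj X i j = sgn n i * star (X j i) * sgn n j := by
  simp [adj, gram]

@[simp] lemma adj_one : adj (1 : Mat n) = 1 := by simp [adj]

@[simp] lemma adj_zero : adj (0 : Mat n) = 0 := by simp [adj]

@[simp] lemma adj_adj (X : Mat n) : adj (adj X) = X := by
  ext i j
  rw [adj_apply, adj_apply]
  simp only [star_mul', star_star, star_sgn]
  linear_combination X i j * (sgn_mul_self i) +
    X i j * (sgn n i) * (sgn n i) * (sgn_mul_self j)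

lemma adj_mul (X Y : Mat n) : adj (X * Y) = adj Y * adj X := by
  simp only [adj, Matrix.conjTranspose_mul, Matrix.mul_assoc]
  rw [← Matrix.mul_assoc (gram n) (gram n), gram_mul_gram, Matrix.one_mul]

lemma adj_add (X Y : Mat n) : adj (X + Y) = adj X + adj Y := by
  simp [adj, Matrix.mul_add, Matrix.add_mul]

lemma adj_sub (X Y : Mat n) : adj (X - Y) = adj X - adj Y := by
  simp [adj, Matrix.mul_sub, Matrix.sub_mul]

lemma adj_smul (c : ℂ) (X : Mat n) : adj (c • X) = star c • adj X := by
  simp [adj]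

lemma adj_real_smul (c : ℝ) (X : Mat n) : adj (c • X) = c • adj X := by
  simp [adj]

lemma adj_diagonal (d : Fin n ⊕ Unit → ℂ) :
    adj (Matrix.diagonal d) = Matrix.diagonal (star d) := by
  ext i j
  rw [adj_apply]
  by_cases h : i = j
  · subst h
    simp only [Matrix.diagonal_apply_eq, Pi.star_apply]
    linear_combination star (d i) * sgn_mul_self i
  · simp [h, Ne.symm h]

/-- `Q` preserves the Hermitian form. -/
def IsPseudoUnitary (Q : Mat n) : Prop := adj Q * Q = 1

namespace IsPseudoUnitary

variable {P Q : Mat n}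

lemma adj_mul_self (h : IsPseudoUnitary Q) : adj Q * Q = 1 := h

lemma mul_adj_self (h : IsPseudoUnitary Q) : Q * adj Q = 1 :=
  mul_eq_one_comm.mp h

lemma mul (hP : IsPseudoUnitary P) (hQ : IsPseudoUnitary Q) : IsPseudoUnitary (P * Q) := by
  rw [IsPseudoUnitary, adj_mul, mul_assoc, ← mul_assoc (adj P), hP.adj_mul_self, one_mul, hQ]

lemma adj (hQ : IsPseudoUnitary Q) : IsPseudoUnitary (adj Q) := by
  rw [IsPseudoUnitary, adj_adj]
  exact hQ.mul_adj_self

lemma smul {c : ℂ} (hc : star c * c = 1) (hQ : IsPseudoUnitary Q) :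
    IsPseudoUnitary (c • Q) := by
  rw [IsPseudoUnitary, adj_smul, smul_mul_smul_comm, hc, hQ.adj_mul_self, one_smul]

lemma star_det_mul_det (hQ : IsPseudoUnitary Q) : star Q.det * Q.det = 1 := by
  have h := congrArg Matrix.det hQ.adj_mul_self
  have hg : (gram n).det * (gram n).det = 1 := by
    rw [← Matrix.det_mul, gram_mul_gram, Matrix.det_one]
  rw [EllipticHorn.adj, Matrix.det_mul, Matrix.det_mul, Matrix.det_mul, Matrix.det_conjTranspose,
    Matrix.det_one] at h
  linear_combination h - star Q.det * Q.det * hg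

end IsPseudoUnitary

lemma isPseudoUnitary_diagonal {d : Fin n ⊕ Unit → ℂ} (hd : ∀ i, star (d i) * d i = 1) :
    IsPseudoUnitary (Matrix.diagonal d) := by
  rw [IsPseudoUnitary, adj_diagonal, Matrix.diagonal_mul_diagonal, ← Matrix.diagonal_one]
  congr 1
  funext i
  exact hd i

lemma hermForm_eq (z w : Vec n) : hermForm n z w = star w ⬝ᵥ (gram n *ᵥ z) := by
  simp [hermForm, gram, sgn, dotProduct, Matrix.mulVec_diagonal, mul_comm, sub_eq_add_neg]

lemma hermForm_mulVec (X : Mat n) (z w : Vec n) :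
    hermForm n (X *ᵥ z) w = hermForm n z (adj X *ᵥ w) := by
  simp only [hermForm_eq, Matrix.star_mulVec, adj, Matrix.conjTranspose_mul,
    Matrix.conjTranspose_conjTranspose, conjTranspose_gram, Matrix.mulVec_mulVec,
    Matrix.dotProduct_mulVec, Matrix.vecMul_vecMul]
  simp only [Matrix.mul_assoc, gram_mul_gram, Matrix.mul_one]

lemma hermForm_single (X : Mat n) (i j : Fin n ⊕ Unit) :
    hermForm n (X *ᵥ Pi.single j 1) (Pi.single i 1) = sgn n i * X i j := by
  rw [hermForm_eq]
  simp [gram, Matrix.mulVec_diagonal, Pi.star_single]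

lemma mem_U_iff (A : GL (Fin n ⊕ Unit) ℂ) :
    A ∈ U n ↔ IsPseudoUnitary (A : Mat n) := by
  constructor
  · intro h
    ext i j
    have h1 := h (Pi.single j 1) (Pi.single i 1)
    have h2 : hermForm n ((adj (A : Mat n) * (A : Mat n)) *ᵥ Pi.single j 1) (Pi.single i 1)
        = hermForm n ((1 : Mat n) *ᵥ Pi.single j 1) (Pi.single i 1) := by
      rw [← Matrix.mulVec_mulVec, hermForm_mulVec, adj_adj, h1, Matrix.one_mulVec]
    rw [hermForm_single, hermForm_single] at h2
    exact mul_left_cancel₀ (sgn_ne_zero i) h2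
  · intro h z w
    rw [hermForm_mulVec, Matrix.mulVec_mulVec, h.adj_mul_self, Matrix.one_mulVec]

lemma isPseudoUnitary_mat (A : U n) : IsPseudoUnitary (mat A) := (mem_U_iff _).mp A.2

/-- The element of `U(n,1)` with a given matrix. -/
def toU (Q : Mat n) (hQ : IsPseudoUnitary Q) : U n :=
  ⟨⟨Q, adj Q, hQ.mul_adj_self, hQ⟩, (mem_U_iff _).mpr hQ⟩

@[simp] lemma mat_toU (Q : Mat n) (hQ : IsPseudoUnitary Q) : mat (toU Q hQ) = Q := rfl

@[simp] lemma mat_mul (A B : U n) : mat (A * B) = mat A * mat B := rfl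

@[simp] lemma mat_one : mat (1 : U n) = 1 := rfl

lemma mat_injective : Function.Injective (mat : U n → Mat n) := fun _ _ h =>
  Subtype.ext (Units.ext h)

/-! ### The center of `U(n,1)` and lifts -/

/-- A vector of positive type mixing the coordinate `k` with the last coordinate. -/
def mixVec (k : Fin n) : Vec n := 2 • Pi.single (Sum.inl k) 1 + Pi.single (Sum.inr ()) 1

/-- The reflection in the hyperplane orthogonal to `mixVec k`. -/
noncomputable def mixReflection (k : Fin n) : Mat n :=
  1 - (2 / 3 : ℂ) • Matrix.vecMulVec (mixVec k) (gram n *ᵥ mixVec k)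

lemma star_mixVec (k : Fin n) : star (mixVec k) = mixVec k := by
  simp [mixVec, Pi.star_single]

lemma isPseudoUnitary_mixReflection (k : Fin n) : IsPseudoUnitary (mixReflection k) := by
  set T : Mat n := Matrix.vecMulVec (mixVec k) (gram n *ᵥ mixVec k) with hT
  have hTT : T * T = (3 : ℂ) • T := by
    rw [hT, Matrix.vecMulVec_mul_vecMulVec, ← Matrix.vecMulVec_smul]
    congr 2
    simp [gram, sgn, mixVec, Matrix.mulVec_diagonal, dotProduct, Pi.single_apply,
      mul_add, add_mul]
    norm_num
  have hadj : adj T = T := by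
    have hs : ∀ i, star (mixVec k i) = mixVec k i := congrFun (star_mixVec k)
    ext i j
    rw [adj_apply, hT]
    simp only [Matrix.vecMulVec_apply, gram, Matrix.mulVec_diagonal, star_mul', hs, star_sgn]
    linear_combination mixVec k i * mixVec k j * sgn n j * sgn_mul_self i
  rw [IsPseudoUnitary, mixReflection, ← hT, adj_sub, adj_smul, adj_one, hadj]
  simp only [sub_mul, mul_sub, one_mul, mul_one, smul_mul_smul_comm, hTT, smul_smul]
  simp only [star_div₀, star_ofNat]
  module

/-- Commuting with diagonal matrices makes a central element diagonal, and commuting with the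
reflections `mixReflection k` makes its diagonal entries equal. -/
lemma center_eq_smul {A : U n} (hA : A ∈ Subgroup.center (U n)) :
    ∃ c : ℂ, mat A = c • (1 : Mat n) := by
  have hcomm : ∀ Q : Mat n, IsPseudoUnitary Q → Q * mat A = mat A * Q := fun Q hQ =>
    congrArg mat (Subgroup.mem_center_iff.mp hA (toU Q hQ))
  have hoff : ∀ i j, i ≠ j → mat A i j = 0 := by
    intro i j hij
    -- the diagonal matrix with an entry `-1` in position `i` and `1` elsewhere
    have h := hcomm (Matrix.diagonal (fun l => if l = i then -1 else 1))
      (isPseudoUnitary_diagonal fun l => by split_ifs <;> simp)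
    have h1 := congrFun (congrFun h i) j
    simp only [Matrix.diagonal_mul, Matrix.mul_diagonal, if_true, if_neg hij.symm] at h1
    linear_combination (-1 / 2 : ℂ) * h1
  refine ⟨mat A (Sum.inr ()) (Sum.inr ()), ?_⟩
  have hdiag : mat A = Matrix.diagonal fun i => mat A i i := by
    ext i j
    by_cases h : i = j
    · subst h; simp
    · simp [h, hoff i j h]
  ext i j
  by_cases h : i = j
  · subst h
    rcases i with k | i
    · have h := hcomm (mixReflection k) (isPseudoUnitary_mixReflection k)
      have h1 := congrFun (congrFun h (Sum.inl k)) (Sum.inr ())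
      rw [hdiag] at h1
      simp only [Matrix.diagonal_mul, Matrix.mul_diagonal] at h1
      have h2 : mixReflection k (Sum.inl k) (Sum.inr ()) = 4 / 3 := by
        simp [mixReflection, mixVec, gram, sgn, Matrix.vecMulVec_apply, Matrix.mulVec_diagonal]
        norm_num
      rw [h2] at h1
      simp only [Matrix.smul_apply, Matrix.one_apply_eq, smul_eq_mul, mul_one]
      linear_combination (-3 / 4 : ℂ) * h1
    · simp
  · simp [h, hoff i j h]

lemma isLift_iff {A B : U n} {g : PU n} (hA : IsLift A g) :
    IsLift B g ↔ ∃ c : ℂ, mat B = c • mat A := by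
  rw [IsLift] at hA
  subst hA
  rw [IsLift, eq_comm, QuotientGroup.eq]
  constructor
  · intro h
    obtain ⟨c, hc⟩ := center_eq_smul h
    refine ⟨c, ?_⟩
    have : mat B = mat A * mat (A⁻¹ * B) := by rw [← mat_mul, mul_inv_cancel_left]
    rw [this, hc, mul_smul_comm, mul_one]
  · rintro ⟨c, hc⟩
    have hAB : mat (A⁻¹ * B) = c • (1 : Mat n) := by
      rw [mat_mul, hc, mul_smul_comm, ← mat_mul, inv_mul_cancel, mat_one]
    rw [Subgroup.mem_center_iff]
    intro g
    apply mat_injective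
    rw [mat_mul g, mat_mul (A⁻¹ * B), hAB]
    simp

/-! ### Uniqueness of angles -/

lemma angleMatrix_entry_unit (α : Fin n → ℝ) (i : Fin n ⊕ Unit) :
    star ((Sum.elim (fun k => Complex.exp (Complex.I * (α k : ℂ))) (fun _ => 1) :
      Fin n ⊕ Unit → ℂ) i) *
      (Sum.elim (fun k => Complex.exp (Complex.I * (α k : ℂ))) (fun _ => 1) :
      Fin n ⊕ Unit → ℂ) i = 1 := by
  rcases i with i | i
  · simp [← Complex.exp_conj, ← Complex.exp_add]
  · simp

lemma isPseudoUnitary_angleMatrix (α : Fin n → ℝ) :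
    IsPseudoUnitary (angleMatrix α : Mat n) :=
  isPseudoUnitary_diagonal (angleMatrix_entry_unit α)

lemma charpoly_diagonal (d : Fin n ⊕ Unit → ℂ) :
    (Matrix.diagonal d).charpoly = ∏ i, (Polynomial.X - Polynomial.C (d i)) := by
  rw [Matrix.charpoly, ← Matrix.det_diagonal]
  congr 1
  ext i j
  by_cases h : i = j
  · subst h; simp
  · simp [h]

lemma exp_injOn : Set.InjOn (fun a : ℝ => Complex.exp (Complex.I * (a : ℂ)))
    (Set.Ico 0 (2 * Real.pi)) := by
  intro a ha b hb hab
  obtain ⟨m, hm⟩ := Complex.exp_eq_exp_iff_exists_int.mp hab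
  have h1 : a = b + m * (2 * Real.pi) := by
    have h2 : Complex.I * (a : ℂ) = Complex.I * ((b + m * (2 * Real.pi) : ℝ) : ℂ) := by
      rw [hm]; push_cast; ring
    exact_mod_cast mul_left_cancel₀ Complex.I_ne_zero h2
  have hpi := Real.pi_pos
  have h3 : (m : ℝ) < 1 := by
    by_contra h
    have := ha.2; have := hb.1
    nlinarith
  have h4 : (-1 : ℝ) < m := by
    by_contra h
    have := ha.1; have := hb.2
    nlinarith
  have h5 : m = 0 := by
    have h6 : m < 1 := by exact_mod_cast h3
    have h7 : -1 < m := by exact_mod_cast h4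
    omega
  simpa [h5] using h1

lemma angles_eq_of_charpoly_eq {α β : Fin n → ℝ} (hα : α ∈ angleSpace n) (hβ : β ∈ angleSpace n)
    (h : (angleMatrix α : Mat n).charpoly = (angleMatrix β : Mat n).charpoly) : α = β := by
  set f : ℝ → ℂ := fun a => Complex.exp (Complex.I * (a : ℂ)) with hf
  have hroots : ∀ γ : Fin n → ℝ, (angleMatrix γ : Mat n).charpoly.roots
      = Finset.univ.val.map (fun k => f (γ k)) + {1} := by
    intro γ
    set d : Fin n ⊕ Unit → ℂ :=
      Sum.elim (fun k => Complex.exp (Complex.I * (γ k : ℂ))) (fun _ => 1) with hd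
    have hm : Finset.univ.val.map (fun i => Polynomial.X - Polynomial.C (d i))
        = (Finset.univ.val.map d).map (fun a => Polynomial.X - Polynomial.C a) := by
      rw [Multiset.map_map]; rfl
    rw [angleMatrix, charpoly_diagonal, Finset.prod_eq_multiset_prod, hm,
      Polynomial.roots_multiset_prod_X_sub_C, ← Finset.univ_disjSum_univ]
    simp [Finset.disjSum, Multiset.disjSum, hf, hd]
  have h1 : Finset.univ.val.map (fun k => f (α k)) = Finset.univ.val.map (fun k => f (β k)) := by
    have := congrArg Polynomial.roots h
    rw [hroots, hroots] at this
    exact add_right_cancel this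
  have h2 := congrArg (Multiset.map (Function.invFunOn f (Set.Ico 0 (2 * Real.pi)))) h1
  have hinv : ∀ γ ∈ angleSpace n, ∀ k,
      Function.invFunOn f (Set.Ico 0 (2 * Real.pi)) (f (γ k)) = γ k := fun γ hγ k =>
    exp_injOn.leftInvOn_invFunOn (hγ.1 k)
  simp only [Multiset.map_map, Function.comp_def, hinv α hα, hinv β hβ] at h2
  rw [← List.ofFn_injective.eq_iff]
  apply List.Perm.eq_of_sortedGE hα.2.sortedGE_ofFn hβ.2.sortedGE_ofFn
  rw [← Multiset.coe_eq_coe]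
  simpa [Fin.univ_val_map] using h2

/-- The last column of a matrix preserving the form has negative type, so its last entry does
not vanish. -/
lemma IsPseudoUnitary.last_ne_zero {Q : Mat n} (hQ : IsPseudoUnitary Q) :
    Q (Sum.inr ()) (Sum.inr ()) ≠ 0 := by
  intro h0
  have h := congrFun (congrFun hQ.adj_mul_self (Sum.inr ())) (Sum.inr ())
  simp only [Matrix.mul_apply, adj_apply, Fintype.sum_sum_type, Finset.univ_unique,
    Finset.sum_singleton, sgn, Sum.elim_inl, Sum.elim_inr, Matrix.one_apply_eq] at h
  have hd : (default : Unit) = () := rfl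
  simp only [hd, h0, one_mul, mul_neg, mul_one, star_zero, mul_zero, add_zero,
    Complex.star_def, neg_mul, Complex.conj_mul', Finset.sum_neg_distrib] at h
  have h1 : ∑ x, ‖Q (Sum.inl x) (Sum.inr ())‖ ^ 2 = -1 := by
    have h2 : ((∑ x, ‖Q (Sum.inl x) (Sum.inr ())‖ ^ 2 : ℝ) : ℂ) = ((-1 : ℝ) : ℂ) := by
      push_cast
      linear_combination -h
    exact_mod_cast h2
  have h2 : 0 ≤ ∑ x, ‖Q (Sum.inl x) (Sum.inr ())‖ ^ 2 :=
    Finset.sum_nonneg fun x _ => by positivity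
  linarith

/-- The last column of the conjugating matrix has negative type, which fixes the lift; then the
angles are read off from the eigenvalues. -/
lemma HasAngles.unique {g : PU n} {α β : Fin n → ℝ} (hα : HasAngles g α) (hβ : HasAngles g β) :
    α = β := by
  obtain ⟨hα, A, hA, P, hP⟩ := hα
  obtain ⟨hβ, B, hB, Q, hQ⟩ := hβ
  obtain ⟨c, hc⟩ := (isLift_iff hA).mp hB
  have hPu := isPseudoUnitary_mat P
  have hQu := isPseudoUnitary_mat Q
  set R : Mat n := adj (mat P) * mat Q with hR
  have hRu : IsPseudoUnitary R := hPu.adj.mul hQu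
  have hA' : mat A = mat P * angleMatrix α * adj (mat P) := by
    rw [← hP, mul_assoc, hPu.mul_adj_self, mul_one]
  have hRel : c • (angleMatrix α * R) = R * angleMatrix β := by
    rw [hR, mul_assoc, ← hQ, hc, hA', smul_mul_assoc, mul_smul_comm]
    simp only [← mul_assoc]
    rw [hPu.adj_mul_self, one_mul]
  -- The last columns show that the two lifts agree.
  have hc1 : c = 1 := by
    have h := congrFun (congrFun hRel (Sum.inr ())) (Sum.inr ())
    simp [angleMatrix] at h
    exact mul_right_cancel₀ hRu.last_ne_zero (h.trans (one_mul _).symm)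
  rw [hc1, one_smul] at hRel
  have hconj : angleMatrix α = R * (angleMatrix β * adj R) := by
    rw [← mul_assoc, ← hRel, mul_assoc, hRu.mul_adj_self, mul_one]
  apply angles_eq_of_charpoly_eq hα hβ
  rw [hconj, Matrix.charpoly_mul_comm, mul_assoc, hRu.adj_mul_self, mul_one]

/-! ### The defining equation in terms of matrices -/

/-- The scalar taking `angleMatrix α` to `standardMatrix α`. -/
noncomputable def phase (α : Fin n → ℝ) : ℂ :=
  Complex.exp (-Complex.I * (((∑ j, α j) / (n + 1) : ℝ) : ℂ))

lemma star_phase_mul_phase (α : Fin n → ℝ) : star (phase α) * phase α = 1 := by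
  simp only [phase, Complex.star_def, ← Complex.exp_conj, ← Complex.exp_add, map_mul, map_neg,
    Complex.conj_I, Complex.conj_ofReal]
  simp

lemma phase_ne_zero (α : Fin n → ℝ) : phase α ≠ 0 := Complex.exp_ne_zero _

lemma standardMatrix_eq (α : Fin n → ℝ) :
    (standardMatrix α : Mat n) = phase α • angleMatrix α := by
  rw [standardMatrix, angleMatrix, ← Matrix.diagonal_smul]
  congr 1
  funext i
  rcases i with k | i
  · have h := Finset.add_sum_erase Finset.univ α (Finset.mem_univ k)
    simp only [Sum.elim_inl, Pi.smul_apply, phase, smul_eq_mul]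
    rw [← Complex.exp_add]
    congr 1
    rw [← h, neg_mul, ← mul_neg, ← mul_add, ← Complex.ofReal_neg, ← Complex.ofReal_add]
    congr 2
    have : (n : ℝ) + 1 ≠ 0 := by positivity
    field_simp
    ring
  · simp [phase]

lemma isPseudoUnitary_standardMatrix (α : Fin n → ℝ) :
    IsPseudoUnitary (standardMatrix α : Mat n) := by
  rw [standardMatrix_eq]
  exact (isPseudoUnitary_angleMatrix α).smul (star_phase_mul_phase α)

lemma det_standardMatrix (α : Fin n → ℝ) : (standardMatrix α : Mat n).det = 1 := by
  rw [standardMatrix_eq, Matrix.det_smul, angleMatrix, Matrix.det_diagonal, phase,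
    Fintype.prod_sum_type]
  simp only [Sum.elim_inl, Sum.elim_inr, Finset.prod_const_one, mul_one, ← Complex.exp_sum,
    ← Complex.exp_nat_mul, ← Complex.exp_add, ← Finset.mul_sum]
  rw [Complex.exp_eq_one_iff]
  refine ⟨0, ?_⟩
  have : (n : ℂ) + 1 ≠ 0 := by exact_mod_cast n.succ_ne_zero
  simp
  field_simp
  ring

/-- The conjugate by `Q` of the standard matrix with angles `α`. -/
noncomputable def conjStandard (Q : Mat n) (α : Fin n → ℝ) : Mat n :=
  Q * standardMatrix α * adj Q

lemma IsPseudoUnitary.conjStandard {Q : Mat n} (hQ : IsPseudoUnitary Q) (α : Fin n → ℝ) :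
    IsPseudoUnitary (conjStandard Q α) :=
  (hQ.mul (isPseudoUnitary_standardMatrix α)).mul hQ.adj

lemma IsPseudoUnitary.det_conjStandard {Q : Mat n} (hQ : IsPseudoUnitary Q) (α : Fin n → ℝ) :
    (EllipticHorn.conjStandard Q α).det = 1 := by
  rw [EllipticHorn.conjStandard, Matrix.det_mul_comm, ← mul_assoc, hQ.adj_mul_self, one_mul,
    det_standardMatrix]

/-- The matrices `Q i` conjugate the standard matrices with angles `τ i` to matrices whose
product is `u`. -/
def Solves (u : ℂ) (τ : Fin 3 → Fin n → ℝ) (Q : Fin 3 → Mat n) : Prop :=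
  (∀ i, IsPseudoUnitary (Q i)) ∧
    conjStandard (Q 0) (τ 0) * conjStandard (Q 1) (τ 1) * conjStandard (Q 2) (τ 2) =
      u • (1 : Mat n)

lemma IsPseudoUnitary.exists_smul_det_eq_one {Q : Mat n} (hQ : IsPseudoUnitary Q) :
    ∃ c : ℂ, star c * c = 1 ∧ (c • Q).det = 1 := by
  obtain ⟨c, hc⟩ := IsAlgClosed.exists_pow_nat_eq (star Q.det) n.succ_pos
  have hd := hQ.star_det_mul_det
  have h1 : ‖Q.det‖ = 1 := by
    have := congrArg norm hd
    rw [norm_mul, norm_star, norm_one] at this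
    nlinarith [norm_nonneg Q.det]
  refine ⟨c, ?_, ?_⟩
  · have h2 : ‖c‖ ^ n.succ = 1 := by rw [← norm_pow, hc, norm_star, h1]
    have h3 : ‖c‖ = 1 := (pow_eq_one_iff_of_nonneg (norm_nonneg c) n.succ_ne_zero).mp h2
    rw [Complex.star_def, Complex.conj_mul', h3]
    simp
  · rw [Matrix.det_smul]
    simp only [Fintype.card_sum, Fintype.card_fin, Fintype.card_unit]
    rw [hc, hd]

/-- A solution of the matrix equation gives a representation with the prescribed angles. -/
lemma Solves.exists_hom {u : ℂ} {τ : Fin 3 → Fin n → ℝ} {Q : Fin 3 → Mat n}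
    (hτ : ∀ i, τ i ∈ angleSpace n) (h : Solves u τ Q) :
    ∃ ρ ∈ HomEllLevel n u, (∀ i, HasAngles (ρ (gen i)) (τ i)) ∧
      ∀ i, ∃ A : U n, IsLift A (ρ (gen i)) ∧ mat A = conjStandard (Q i) (τ i) := by
  obtain ⟨hQ, hprod⟩ := h
  let A : Fin 3 → U n := fun i => toU _ ((hQ i).conjStandard (τ i))
  have hrel : ∀ r ∈ ({FreeGroup.of 0 * FreeGroup.of 1 * FreeGroup.of 2} :
      Set (FreeGroup (Fin 3))),
      FreeGroup.lift (fun i => (QuotientGroup.mk (A i) : PU n)) r = 1 := by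
    rintro r rfl
    simp only [map_mul, FreeGroup.lift_apply_of]
    have h1 : IsLift (1 : U n) (1 : PU n) := rfl
    exact (isLift_iff h1).mpr ⟨u, hprod⟩
  have hgen : ∀ i, PresentedGroup.toGroup hrel (gen i) = (QuotientGroup.mk (A i) : PU n) :=
    fun i => PresentedGroup.toGroup.of hrel
  have hlift : ∀ i, IsLift (A i) (PresentedGroup.toGroup hrel (gen i)) := fun i => (hgen i).symm
  have hang : ∀ i, HasAngles (PresentedGroup.toGroup hrel (gen i)) (τ i) := by
    intro i
    have hpu : IsPseudoUnitary (star (phase (τ i)) • mat (A i)) := by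
      apply (isPseudoUnitary_mat (A i)).smul
      rw [star_star, mul_comm, star_phase_mul_phase]
    refine ⟨hτ i, toU _ hpu, (isLift_iff (hlift i)).mpr ⟨_, rfl⟩, toU _ (hQ i), ?_⟩
    simp only [mat_toU, A, conjStandard, standardMatrix_eq]
    rw [mul_smul_comm, smul_mul_assoc, smul_mul_assoc, smul_mul_assoc, smul_smul,
      star_phase_mul_phase, one_smul, mul_assoc, (hQ i).adj_mul_self, mul_one]
  refine ⟨PresentedGroup.toGroup hrel, ⟨?_, ?_⟩, hang, fun i => ⟨A i, hlift i, rfl⟩⟩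
  · intro i
    obtain ⟨-, B, hB, P, hP⟩ := hang i
    refine ⟨B, hB, mat P *ᵥ Pi.single (Sum.inr ()) 1, ?_, 1, ?_⟩
    · have := P.2 (Pi.single (Sum.inr ()) 1) (Pi.single (Sum.inr ()) 1)
      rw [mat, this]
      simp [hermForm]
    · rw [Matrix.mulVec_mulVec, hP, ← Matrix.mulVec_mulVec, one_smul]
      congr 1
      ext j
      simp [angleMatrix, Matrix.mulVec_diagonal, Pi.single_apply]
      by_cases h : j = Sum.inr ()
      · subst h; simp
      · simp [h]
  · refine ⟨fun i => ⟨A i, (hQ i).det_conjStandard (τ i)⟩, fun i => ⟨hlift i, τ i, hang i, ?_⟩,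
      hprod⟩
    obtain ⟨c, hc, hdet⟩ := (hQ i).exists_smul_det_eq_one
    refine ⟨⟨toU _ ((hQ i).smul hc), hdet⟩, ?_⟩
    change conjStandard (Q i) (τ i) * (c • Q i) = (c • Q i) * standardMatrix (τ i)
    rw [mul_smul_comm, smul_mul_assoc, conjStandard, mul_assoc, (hQ i).adj_mul_self, mul_one]

lemma mem_solutionSet_iff {u : ℂ} {τ : Fin 3 → Fin n → ℝ} :
    τ ∈ solutionSet n u ↔ (∀ i, τ i ∈ angleSpace n) ∧ ∃ Q, Solves u τ Q := by
  constructor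
  · rintro ⟨ρ, ⟨-, A, hA, hprod⟩, hτ⟩
    refine ⟨fun i => (hτ i).1, ?_⟩
    choose hlift α hα Q hQ using hA
    refine ⟨fun i => mat (Q i : U n), fun i => isPseudoUnitary_mat _, ?_⟩
    have hconj : ∀ i, mat (A i : U n) = conjStandard (mat (Q i : U n)) (τ i) := by
      intro i
      rw [conjStandard, (hτ i).unique (hα i), ← hQ i, mul_assoc,
        (isPseudoUnitary_mat _).mul_adj_self, mul_one]
    rw [← hconj, ← hconj, ← hconj, hprod]
  · rintro ⟨hτ, Q, hQ⟩
    obtain ⟨ρ, hρ, hang, -⟩ := hQ.exists_hom hτ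
    exact ⟨ρ, hρ, hang⟩

/-- Off the reducible set, the matrices of a solution have no common invariant subspace. -/
lemma Solves.eq_bot_or_eq_top {u : ℂ} {τ : Fin 3 → Fin n → ℝ} {Q : Fin 3 → Mat n}
    (h : Solves u τ Q) (hτ : ∀ i, τ i ∈ angleSpace n) (hred : τ ∉ reducibleSet n u)
    (W : Submodule ℂ (Vec n)) (hW : ∀ i, ∀ v ∈ W, conjStandard (Q i) (τ i) *ᵥ v ∈ W) :
    W = ⊥ ∨ W = ⊤ := by
  by_contra hne
  push Not at hne
  obtain ⟨ρ, hρ, hang, hA⟩ := h.exists_hom hτ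
  refine hred ⟨ρ, hρ, ⟨W, hne.1, hne.2, fun i B hB v hv => ?_⟩, hang⟩
  obtain ⟨A, hA, hmat⟩ := hA i
  obtain ⟨c, hc⟩ := (isLift_iff hA).mp hB
  rw [hc, hmat, Matrix.smul_mulVec]
  exact W.smul_mem c (hW i v hv)

/-! ### Properness -/

section Properness

open Filter Topology
open scoped Matrix.Norms.Operator

/-- The columns of a matrix with `adj Q * Q = 0` are null and mutually orthogonal, written out. -/
lemma null_columns_inner {Q : Mat n} (h : adj Q * Q = 0) (a b : Fin n ⊕ Unit) :
    ∑ x, star (Q (Sum.inl x) a) * Q (Sum.inl x) b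
      = star (Q (Sum.inr ()) a) * Q (Sum.inr ()) b := by
  have h1 := congrFun (congrFun h a) b
  simp only [Matrix.mul_apply, adj_apply, Fintype.sum_sum_type, Finset.univ_unique,
    Finset.sum_singleton, Matrix.zero_apply] at h1
  simp only [mul_assoc, ← Finset.mul_sum] at h1
  rw [← mul_add] at h1
  have h2 := (mul_eq_zero.mp h1).resolve_left (sgn_ne_zero a)
  have hu : (default : Unit) = () := rfl
  simp [sgn, hu] at h2
  simp only [Complex.star_def]
  linear_combination h2

/-- Orthogonal null vectors are proportional, because the form is positive definite on vectors with
vanishing last coordinate. -/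
lemma null_columns {Q : Mat n} (h : adj Q * Q = 0) (i j k : Fin n ⊕ Unit) :
    Q k i * Q (Sum.inr ()) j = Q k j * Q (Sum.inr ()) i := by
  have hcol := null_columns_inner h
  -- The combination of the two columns whose last entry vanishes is null, hence zero.
  set p := Q (Sum.inr ()) i
  set q := Q (Sum.inr ()) j
  have hz : ∑ x, star (Q (Sum.inl x) i * q - Q (Sum.inl x) j * p) *
      (Q (Sum.inl x) i * q - Q (Sum.inl x) j * p) = 0 := by
    have he : ∀ x : Fin n, star (Q (Sum.inl x) i * q - Q (Sum.inl x) j * p) *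
      (Q (Sum.inl x) i * q - Q (Sum.inl x) j * p) =
        star q * q * (star (Q (Sum.inl x) i) * Q (Sum.inl x) i)
        - star q * p * (star (Q (Sum.inl x) i) * Q (Sum.inl x) j)
        - star p * q * (star (Q (Sum.inl x) j) * Q (Sum.inl x) i)
        + star p * p * (star (Q (Sum.inl x) j) * Q (Sum.inl x) j) := by
      intro x
      simp only [star_sub, star_mul']
      ring
    simp only [he, Finset.sum_add_distrib, Finset.sum_sub_distrib, ← Finset.mul_sum, hcol]
    ring
  have hz' : ∑ x, ‖Q (Sum.inl x) i * q - Q (Sum.inl x) j * p‖ ^ 2 = 0 := by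
    simp only [Complex.star_def, Complex.conj_mul'] at hz
    exact_mod_cast hz
  rcases k with k | k
  · have := (Finset.sum_eq_zero_iff_of_nonneg fun x _ => by positivity).mp hz' k
      (Finset.mem_univ k)
    exact sub_eq_zero.mp (norm_eq_zero.mp (pow_eq_zero_iff two_ne_zero |>.mp this))
  · exact mul_comm _ _

/-- An elliptic element whose eigenvalue of negative type is simple moves every null direction
off its orthogonal hyperplane. -/
lemma standardMatrix_null_ne_zero {α : Fin n → ℝ} (hα : α ∈ angleSpace n) (hα0 : ∀ k, α k ≠ 0)
    {v : Vec n} (hv : v ≠ 0) (hnull : hermForm n v v = 0) :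
    hermForm n (standardMatrix α *ᵥ v) v ≠ 0 := by
  have hnull' : ∑ k, v (Sum.inl k) * star (v (Sum.inl k))
      = v (Sum.inr ()) * star (v (Sum.inr ())) := by
    rw [hermForm] at hnull
    exact sub_eq_zero.mp hnull
  have hne : ∃ k, v (Sum.inl k) ≠ 0 := by
    by_contra h
    push Not at h
    simp only [h, zero_mul, Finset.sum_const_zero] at hnull'
    apply hv
    ext (k | k)
    · exact h k
    · simpa using hnull'.symm
  obtain ⟨k₀, hk₀⟩ := hne
  rw [standardMatrix_eq, Matrix.smul_mulVec]
  have h1 : hermForm n (phase α • (angleMatrix α *ᵥ v)) v =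
      phase α * ∑ k, (Complex.exp (Complex.I * (α k : ℂ)) - 1) *
        (v (Sum.inl k) * star (v (Sum.inl k))) := by
    simp only [sub_mul, one_mul, Finset.sum_sub_distrib, hnull']
    simp only [hermForm, angleMatrix, Pi.smul_apply, Matrix.mulVec_diagonal, smul_eq_mul,
      Sum.elim_inl, Sum.elim_inr, one_mul, mul_sub, Finset.mul_sum, mul_assoc]
  rw [h1]
  refine mul_ne_zero (phase_ne_zero α) fun h => ?_
  have hre : ∀ k, ((Complex.exp (Complex.I * (α k : ℂ)) - 1) *
      (v (Sum.inl k) * star (v (Sum.inl k)))).re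
      = (Real.cos (α k) - 1) * ‖v (Sum.inl k)‖ ^ 2 := by
    intro k
    rw [Complex.star_def, Complex.mul_conj', mul_comm Complex.I, ← Complex.ofReal_pow,
      Complex.re_mul_ofReal, Complex.sub_re, Complex.exp_ofReal_mul_I_re, Complex.one_re]
  have h2 := congrArg Complex.re h
  rw [Complex.re_sum, Finset.sum_congr rfl fun k _ => hre k, Complex.zero_re] at h2
  have hcos : Real.cos (α k₀) < 1 := by
    refine lt_of_le_of_ne (Real.cos_le_one _) fun h => hα0 k₀ ?_
    refine (Real.cos_eq_one_iff_of_lt_of_lt ?_ (hα.1 k₀).2).mp h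
    have := (hα.1 k₀).1; have := Real.pi_pos; linarith
  refine absurd h2 (ne_of_lt (Finset.sum_neg' (fun k _ => ?_) ⟨k₀, Finset.mem_univ _, ?_⟩))
  · have := Real.cos_le_one (α k)
    exact mul_nonpos_of_nonpos_of_nonneg (by linarith) (by positivity)
  · have := norm_pos_iff.mpr hk₀
    exact mul_neg_of_neg_of_pos (by linarith) (by positivity)

/-- The degenerate limits of `Q / ‖Q‖`, for `Q` preserving the form, are rank one operators
between null lines; the trace is then the product of two nonzero values of the form. -/
lemma trace_degenerate_ne_zero {α β : Fin n → ℝ} (hα : α ∈ angleSpace n) (hα0 : ∀ k, α k ≠ 0)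
    (hβ : β ∈ angleSpace n) (hβ0 : ∀ k, β k ≠ 0) {N : Mat n} (hN : N ≠ 0)
    (h₁ : adj N * N = 0) (h₂ : N * adj N = 0) :
    (standardMatrix α * conjStandard N β).trace ≠ 0 := by
  obtain ⟨m, hm⟩ : ∃ m, N (Sum.inr ()) m ≠ 0 := by
    by_contra h
    push Not at h
    apply hN
    ext i j
    have h3 := null_columns_inner h₁ j j
    simp only [h, star_zero, zero_mul, Complex.star_def, Complex.conj_mul'] at h3
    have h4 : ∑ x, ‖N (Sum.inl x) j‖ ^ 2 = 0 := by exact_mod_cast h3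
    rcases i with i | i
    · have := (Finset.sum_eq_zero_iff_of_nonneg fun x _ => by positivity).mp h4 i
        (Finset.mem_univ i)
      simpa using this
    · exact h j
  set v : Vec n := fun i => N i m with hv
  set w : Vec n := fun j => star (N (Sum.inr ()) j / N (Sum.inr ()) m) with hw
  have hNvw : N = Matrix.vecMulVec v (star w) := by
    ext i j
    have := null_columns h₁ j m i
    simp only [Matrix.vecMulVec_apply, hv, hw, Pi.star_apply, star_star]
    field_simp
    exact this
  have hv0 : v ≠ 0 := fun h => hm (congrFun h _)
  have hw0 : w ≠ 0 := fun h => by simpa [hw, hm] using congrFun h m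
  have hadj : adj N = Matrix.vecMulVec (gram n *ᵥ w) (star v ᵥ* gram n) := by
    rw [hNvw, adj, Matrix.conjTranspose_vecMulVec, star_star, Matrix.mul_vecMulVec,
      Matrix.vecMulVec_mul]
  have hg : ∀ x y : Vec n, (x ᵥ* gram n) ⬝ᵥ y = x ⬝ᵥ (gram n *ᵥ y) := fun x y =>
    (Matrix.dotProduct_mulVec _ _ _).symm
  have hvnull : hermForm n v v = 0 := by
    rw [hadj] at h₁
    nth_rewrite 1 [hNvw] at h₁
    have h3 := congrFun (congrFun h₁ m) m
    rw [Matrix.vecMulVec_mul_vecMulVec, hg, ← hermForm_eq, Matrix.vecMulVec_smul] at h3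
    have hwm : w m = 1 := by simp [hw, hm]
    simpa [Matrix.vecMulVec_apply, gram, Matrix.mulVec_diagonal, hwm, sgn_ne_zero] using h3
  have hwnull : hermForm n w w = 0 := by
    rw [hadj] at h₂
    nth_rewrite 1 [hNvw] at h₂
    have h3 := congrFun (congrFun h₂ (Sum.inr ())) (Sum.inr ())
    rw [Matrix.vecMulVec_mul_vecMulVec, ← hermForm_eq, Matrix.vecMulVec_smul] at h3
    simpa [Matrix.vecMulVec_apply, gram, Matrix.vecMul_diagonal, hv, hm, sgn_ne_zero] using h3
  have hcomm : gram n * standardMatrix β = standardMatrix β * gram n := by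
    simp only [gram, standardMatrix, Matrix.diagonal_mul_diagonal, mul_comm]
  have key : (standardMatrix α * conjStandard N β).trace =
      hermForm n (standardMatrix β *ᵥ w) w * hermForm n (standardMatrix α *ᵥ v) v := by
    rw [conjStandard, hadj]
    nth_rewrite 1 [hNvw]
    rw [mul_assoc, Matrix.mul_vecMulVec, Matrix.vecMulVec_mul_vecMulVec, Matrix.mulVec_mulVec,
      ← hcomm, ← Matrix.mulVec_mulVec, ← hermForm_eq, Matrix.vecMulVec_smul,
      Matrix.mul_smul, Matrix.mul_vecMulVec, Matrix.trace_smul, Matrix.trace_vecMulVec,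
      dotProduct_comm, hg, ← hermForm_eq, smul_eq_mul]
  rw [key]
  exact mul_ne_zero (standardMatrix_null_ne_zero hβ hβ0 hw0 hwnull)
    (standardMatrix_null_ne_zero hα hα0 hv0 hvnull)

lemma contDiff_cexp_mul_ofReal {E : Type*} [NormedAddCommGroup E] [NormedSpace ℝ E] {f : E → ℝ}
    (hf : ContDiff ℝ 1 f) (c : ℂ) : ContDiff ℝ 1 fun x => Complex.exp (c * (f x : ℂ)) := by
  have h : ContDiff ℝ 1 fun x => (f x : ℂ) := Complex.ofRealCLM.contDiff.comp hf
  have h2 : ContDiff ℝ 1 fun x => c * (f x : ℂ) := contDiff_const.mul h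
  exact h2.cexp

lemma contDiff_standardMatrix : ContDiff ℝ 1 (standardMatrix : (Fin n → ℝ) → Mat n) := by
  unfold standardMatrix
  have h : ContDiff ℝ 1 fun α : Fin n → ℝ => (Sum.elim
      (fun k => Complex.exp (Complex.I *
        (((n * α k - ∑ j ∈ Finset.univ.erase k, α j) / (n + 1) : ℝ) : ℂ)))
      (fun _ => Complex.exp (-Complex.I * (((∑ j, α j) / (n + 1) : ℝ) : ℂ))) :
        Fin n ⊕ Unit → ℂ) := by
    rw [contDiff_pi]
    rintro (k | k)
    · exact contDiff_cexp_mul_ofReal (by fun_prop) _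
    · exact contDiff_cexp_mul_ofReal (by fun_prop) _
  have hd : ContDiff ℝ 1 fun d : Fin n ⊕ Unit → ℂ => (Matrix.diagonal d : Mat n) :=
    (LinearMap.toContinuousLinearMap
    (Matrix.diagonalLinearMap (Fin n ⊕ Unit) ℝ ℂ)).contDiff
  exact hd.comp h

lemma continuous_standardMatrix : Continuous (standardMatrix : (Fin n → ℝ) → Mat n) :=
  contDiff_standardMatrix.continuous

lemma continuous_adj : Continuous (adj : Mat n → Mat n) := by
  exact (continuous_const.matrix_mul continuous_id.matrix_conjTranspose).matrix_mul
    continuous_const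

/-- Matrices preserving the form along which the trace of a product of two elliptic elements
stays bounded converge along every ultrafilter. -/
lemma tendsto_of_trace_bounded {X : Type*} (F : Ultrafilter X) {α β : X → Fin n → ℝ}
    {α₀ β₀ : Fin n → ℝ} (hα : Tendsto α F (𝓝 α₀)) (hβ : Tendsto β F (𝓝 β₀))
    (hα₀ : α₀ ∈ angleSpace n) (hα₀' : ∀ k, α₀ k ≠ 0)
    (hβ₀ : β₀ ∈ angleSpace n) (hβ₀' : ∀ k, β₀ k ≠ 0)
    {Q : X → Mat n} (hQ : ∀ᶠ x in (F : Filter X), IsPseudoUnitary (Q x)) {K : ℝ}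
    (hK : ∀ᶠ x in (F : Filter X),
      ‖(standardMatrix (α x) * conjStandard (Q x) (β x)).trace‖ ≤ K) :
    ∃ Q₀, Tendsto Q F (𝓝 Q₀) := by
  have : ProperSpace (Mat n) := FiniteDimensional.proper ℂ _
  have hlim : ∀ (R : ℝ) (P : X → Mat n), (∀ᶠ x in (F : Filter X), ‖P x‖ ≤ R) →
      ∃ P₀, Tendsto P F (𝓝 P₀) := by
    intro R P hP
    obtain ⟨P₀, -, hP₀⟩ := (isCompact_closedBall (0 : Mat n) R).ultrafilter_le_nhds' (F.map P)
      (hP.mono fun x hx => mem_closedBall_zero_iff.mpr hx)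
    exact ⟨P₀, hP₀⟩
  by_cases hb : ∃ R : ℝ, ∀ᶠ x in (F : Filter X), ‖Q x‖ ≤ R
  · obtain ⟨R, hR⟩ := hb
    exact hlim R Q hR
  exfalso
  push Not at hb
  have hinf : Tendsto (fun x => ‖Q x‖) F atTop := by
    rw [tendsto_atTop]
    intro R
    filter_upwards [hb R] with x hx using hx.le
  have hinv : Tendsto (fun x => ((‖Q x‖⁻¹ : ℝ) : ℂ)) F (𝓝 0) := by
    have := (Complex.continuous_ofReal.tendsto 0).comp hinf.inv_tendsto_atTop
    simpa [Function.comp_def] using this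
  set P : X → Mat n := fun x => ((‖Q x‖⁻¹ : ℝ) : ℂ) • Q x with hPdef
  have hP1 : ∀ᶠ x in (F : Filter X), ‖P x‖ = 1 := by
    filter_upwards [hinf.eventually_gt_atTop 0] with x hx
    rw [hPdef, norm_smul, Complex.norm_real, norm_inv, norm_norm, inv_mul_cancel₀ hx.ne']
  obtain ⟨N, hN⟩ := hlim 1 P (hP1.mono fun x hx => hx.le)
  have hN0 : N ≠ 0 := by
    have h1 : ‖N‖ = 1 := tendsto_nhds_unique hN.norm
      (tendsto_const_nhds.congr' (hP1.mono fun x hx => hx.symm))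
    intro h
    simp [h] at h1
  have hadjP : ∀ x, adj (P x) = ((‖Q x‖⁻¹ : ℝ) : ℂ) • adj (Q x) := by
    intro x
    rw [hPdef, adj_smul, Complex.star_def, Complex.conj_ofReal]
  have hadjN := (continuous_adj.tendsto N).comp hN
  have hsq : Tendsto (fun x => ((‖Q x‖⁻¹ : ℝ) : ℂ) * ((‖Q x‖⁻¹ : ℝ) : ℂ)) F (𝓝 0) := by
    simpa using hinv.mul hinv
  have hsq1 : Tendsto (fun x => (((‖Q x‖⁻¹ : ℝ) : ℂ) * ((‖Q x‖⁻¹ : ℝ) : ℂ)) • (1 : Mat n)) F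
      (𝓝 0) := by
    simpa using hsq.smul_const (1 : Mat n)
  have h₁ : adj N * N = 0 := by
    refine tendsto_nhds_unique (hadjN.mul hN) (hsq1.congr' ?_)
    filter_upwards [hQ] with x hx
    rw [Function.comp_apply, hadjP, smul_mul_smul_comm, hx.adj_mul_self]
  have h₂ : N * adj N = 0 := by
    refine tendsto_nhds_unique (hN.mul hadjN) (hsq1.congr' ?_)
    filter_upwards [hQ] with x hx
    rw [Function.comp_apply, hadjP, smul_mul_smul_comm, hx.mul_adj_self]
  refine trace_degenerate_ne_zero hα₀ hα₀' hβ₀ hβ₀' hN0 h₁ h₂ ?_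
  have hSα := (continuous_standardMatrix.tendsto α₀).comp hα
  have hSβ := (continuous_standardMatrix.tendsto β₀).comp hβ
  have htr : Continuous (Matrix.trace : Mat n → ℂ) := continuous_id.matrix_trace
  have hlimtr := (htr.tendsto _).comp (hSα.mul ((hN.mul hSβ).mul hadjN))
  refine tendsto_nhds_unique hlimtr ?_
  have hbd : Tendsto (fun x => ‖((‖Q x‖⁻¹ : ℝ) : ℂ) * ((‖Q x‖⁻¹ : ℝ) : ℂ)‖ * K) F (𝓝 0) := by
    simpa using hsq.norm.mul_const K
  refine squeeze_zero_norm' ?_ hbd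
  filter_upwards [hK] with x hx
  simp only [Function.comp_apply, hadjP]
  simp only [hPdef, smul_mul_assoc, mul_smul_comm, Matrix.trace_smul, smul_smul, smul_eq_mul]
  rw [norm_mul]
  exact mul_le_mul_of_nonneg_left hx (norm_nonneg _)

lemma norm_trace_standardMatrix_adj_le (α : Fin n → ℝ) :
    ‖(adj (standardMatrix α) : Mat n).trace‖ ≤ n + 1 := by
  have hu : ∀ i, ‖(standardMatrix α : Mat n) i i‖ = 1 := by
    intro i
    rw [standardMatrix, Matrix.diagonal_apply_eq]
    rcases i with k | k
    · rw [Sum.elim_inl, mul_comm, Complex.norm_exp_ofReal_mul_I]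
    · rw [Sum.elim_inr, neg_mul, ← mul_neg, mul_comm, ← Complex.ofReal_neg,
        Complex.norm_exp_ofReal_mul_I]
  rw [Matrix.trace]
  refine (norm_sum_le _ _).trans ?_
  have : ∀ i, ‖(adj (standardMatrix α) : Mat n).diag i‖ = 1 := by
    intro i
    rw [Matrix.diag_apply, adj_apply, mul_right_comm, sgn_mul_self, one_mul, norm_star, hu]
  rw [Finset.sum_congr rfl fun i _ => this i]
  simp

lemma Solves.star_mul_self_eq_one {u : ℂ} {τ : Fin 3 → Fin n → ℝ} {Q : Fin 3 → Mat n}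
    (h : Solves u τ Q) : star u * u = 1 := by
  have hp := (((h.1 0).conjStandard (τ 0)).mul ((h.1 1).conjStandard (τ 1))).mul
    ((h.1 2).conjStandard (τ 2))
  rw [h.2, IsPseudoUnitary, adj_smul, adj_one, smul_mul_smul_comm, one_mul] at hp
  simpa using congrFun (congrFun hp (Sum.inr ())) (Sum.inr ())

lemma adj_conjStandard (Q : Mat n) (α : Fin n → ℝ) :
    adj (conjStandard Q α) = Q * adj (standardMatrix α) * adj Q := by
  rw [conjStandard, adj_mul, adj_mul, adj_adj, mul_assoc]

lemma norm_trace_smul_adj_conjStandard_le {u : ℂ} (hu : star u * u = 1) {Q : Mat n}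
    (hQ : IsPseudoUnitary Q) (α : Fin n → ℝ) :
    ‖(u • adj (conjStandard Q α)).trace‖ ≤ n + 1 := by
  have hu1 : ‖u‖ = 1 := by
    have := congrArg norm hu
    rw [norm_mul, norm_star, norm_one] at this
    nlinarith [norm_nonneg u]
  rw [Matrix.trace_smul, norm_smul, hu1, one_mul, adj_conjStandard, Matrix.trace_mul_comm,
    ← mul_assoc, hQ.adj_mul_self, one_mul]
  exact norm_trace_standardMatrix_adj_le α

/-- After a simultaneous conjugation the first conjugating matrix is the identity. -/
lemma Solves.normalize {u : ℂ} {τ : Fin 3 → Fin n → ℝ} {Q : Fin 3 → Mat n}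
    (h : Solves u τ Q) : Solves u τ (fun i => adj (Q 0) * Q i) := by
  refine ⟨fun i => (h.1 0).adj.mul (h.1 i), ?_⟩
  have hc : ∀ i, conjStandard (adj (Q 0) * Q i) (τ i) =
      adj (Q 0) * conjStandard (Q i) (τ i) * Q 0 := by
    intro i
    simp only [conjStandard, adj_mul, adj_adj, mul_assoc]
  have hcancel : ∀ Y : Mat n, Q 0 * (adj (Q 0) * Y) = Y := fun Y => by
    rw [← mul_assoc, (h.1 0).mul_adj_self, one_mul]
  have h2 := h.2
  simp only [hc, mul_assoc, hcancel] at h2 ⊢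
  rw [← mul_assoc (conjStandard (Q 1) _), ← mul_assoc (conjStandard (Q 0) _), h2, smul_mul_assoc,
    one_mul, mul_smul_comm, (h.1 0).adj_mul_self]

/-- The solution set is closed in the space of triples with nonzero angles. -/
lemma mem_solutionSet_of_mem_closure {u : ℂ} {τ : Fin 3 → Fin n → ℝ}
    (hτ : τ ∈ nonzeroAngleTriples n) (hcl : τ ∈ closure (solutionSet n u)) :
    τ ∈ solutionSet n u := by
  obtain ⟨F, hF, hFτ⟩ := mem_closure_iff_ultrafilter.mp hcl
  have hsol : ∀ σ ∈ solutionSet n u, ∃ Q : Fin 3 → Mat n, Solves u σ Q ∧ Q 0 = 1 := by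
    intro σ hσ
    obtain ⟨-, Q, hQ⟩ := mem_solutionSet_iff.mp hσ
    exact ⟨_, hQ.normalize, (hQ.1 0).adj_mul_self⟩
  have hex : ∃ Q : (Fin 3 → Fin n → ℝ) → Fin 3 → Mat n,
      ∀ σ ∈ solutionSet n u, Solves u σ (Q σ) ∧ Q σ 0 = 1 := by
    choose! Q hQ using hsol
    exact ⟨Q, hQ⟩
  obtain ⟨Q, hQ⟩ := hex
  have hev : ∀ᶠ σ in (F : Filter _), Solves u σ (Q σ) ∧ Q σ 0 = 1 := by
    filter_upwards [hF] with σ hσ using hQ σ hσ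
  have hang : ∀ i, Tendsto (fun σ : Fin 3 → Fin n → ℝ => σ i) F (𝓝 (τ i)) := fun i =>
    ((continuous_apply i).tendsto τ).mono_left hFτ
  have hcS : ∀ α : Fin n → ℝ, conjStandard 1 α = (standardMatrix α : Mat n) := by
    intro α
    simp [conjStandard]
  have hlim : ∀ i, ∃ Q₀, Tendsto (fun σ => Q σ i) F (𝓝 Q₀) := by
    intro i
    fin_cases i
    · exact ⟨1, tendsto_const_nhds.congr' (hev.mono fun σ hσ => hσ.2.symm)⟩
    · -- the trace of the product of the first two factors is the trace of the inverse of the third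
      refine tendsto_of_trace_bounded F (hang 0) (hang 1) (hτ 0).1 (hτ 0).2 (hτ 1).1 (hτ 1).2
        (hev.mono fun σ hσ => hσ.1.1 1) (K := n + 1) (hev.mono fun σ hσ => ?_)
      have h2 := hσ.1.2
      have hu := hσ.1.star_mul_self_eq_one
      have h3 : standardMatrix (σ 0) * conjStandard (Q σ 1) (σ 1)
          = u • adj (conjStandard (Q σ 2) (σ 2)) := by
        rw [hσ.2, hcS] at h2
        have h4 := congrArg (· * adj (conjStandard (Q σ 2) (σ 2))) h2
        simpa [mul_assoc, ((hσ.1.1 2).conjStandard (σ 2)).mul_adj_self] using h4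
      change ‖(standardMatrix (σ 0) * conjStandard (Q σ 1) (σ 1)).trace‖ ≤ n + 1
      rw [h3]
      exact norm_trace_smul_adj_conjStandard_le hu (hσ.1.1 2) _
    · -- up to cyclic permutation the first and the third factor are adjacent as well
      refine tendsto_of_trace_bounded F (hang 0) (hang 2) (hτ 0).1 (hτ 0).2 (hτ 2).1 (hτ 2).2
        (hev.mono fun σ hσ => hσ.1.1 2) (K := n + 1) (hev.mono fun σ hσ => ?_)
      have h2 := hσ.1.2
      have hu := hσ.1.star_mul_self_eq_one
      rw [hσ.2, hcS] at h2
      have hB := (hσ.1.1 1).conjStandard (σ 1)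
      have hA := isPseudoUnitary_standardMatrix (σ 0)
      have h3 : conjStandard (Q σ 2) (σ 2) * standardMatrix (σ 0)
          = u • adj (conjStandard (Q σ 1) (σ 1)) := by
        have h4 : conjStandard (Q σ 2) (σ 2)
            = adj (conjStandard (Q σ 1) (σ 1)) * (adj (standardMatrix (σ 0)) *
              (standardMatrix (σ 0) * conjStandard (Q σ 1) (σ 1) *
                conjStandard (Q σ 2) (σ 2))) := by
          simp only [← mul_assoc]
          rw [mul_assoc (adj (conjStandard (Q σ 1) (σ 1))), hA.adj_mul_self, mul_one,
            hB.adj_mul_self, one_mul]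
        rw [h4, h2, mul_smul_comm, mul_one, mul_smul_comm, smul_mul_assoc, mul_assoc,
          hA.adj_mul_self, mul_one]
      change ‖(standardMatrix (σ 0) * conjStandard (Q σ 2) (σ 2)).trace‖ ≤ n + 1
      rw [Matrix.trace_mul_comm, h3]
      exact norm_trace_smul_adj_conjStandard_le hu (hσ.1.1 1) _
  choose Q₀ hQ₀ using hlim
  refine mem_solutionSet_iff.mpr ⟨fun i => (hτ i).1, Q₀, fun i => ?_, ?_⟩
  · have h1 := ((continuous_adj.tendsto _).comp (hQ₀ i)).mul (hQ₀ i)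
    refine tendsto_nhds_unique h1 (tendsto_const_nhds.congr' (hev.mono fun σ hσ => ?_))
    exact (hσ.1.1 i).symm
  · have hc : ∀ i, Tendsto (fun σ => conjStandard (Q σ i) (σ i)) F
        (𝓝 (conjStandard (Q₀ i) (τ i))) := fun i =>
      ((hQ₀ i).mul ((continuous_standardMatrix.tendsto _).comp (hang i))).mul
        ((continuous_adj.tendsto _).comp (hQ₀ i))
    refine tendsto_nhds_unique (((hc 0).mul (hc 1)).mul (hc 2))
      (tendsto_const_nhds.congr' (hev.mono fun σ hσ => ?_))
    exact hσ.1.2.symm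

end Properness

/-! ### Infinitesimal surjectivity at irreducible solutions -/

/-- The logarithmic derivative of the product of three matrices `A i` under infinitesimal
conjugations by `X i`. -/
def infinitesimalProduct (A X : Fin 3 → Mat n) : Mat n :=
  (X 0 - A 0 * X 0 * adj (A 0)) + A 0 * (X 1 - A 1 * X 1 * adj (A 1)) * adj (A 0) +
    A 0 * A 1 * (X 2 - A 2 * X 2 * adj (A 2)) * adj (A 0 * A 1)

lemma adj_infinitesimalProduct (A X : Fin 3 → Mat n) :
    adj (infinitesimalProduct A X) = infinitesimalProduct A (fun i => adj (X i)) := by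
  simp only [infinitesimalProduct, adj_add, adj_sub, adj_mul, adj_adj, mul_assoc]

lemma infinitesimalProduct_sub (A X Y : Fin 3 → Mat n) :
    infinitesimalProduct A (X - Y) = infinitesimalProduct A X - infinitesimalProduct A Y := by
  simp only [infinitesimalProduct, Pi.sub_apply]
  noncomm_ring

/-- The complex linear map sending infinitesimal conjugations and a scalar to the resulting
logarithmic derivative. -/
def infinitesimalMap (A : Fin 3 → Mat n) : ((Fin 3 → Mat n) × ℂ) →ₗ[ℂ] Mat n where
  toFun p := infinitesimalProduct A p.1 + p.2 • (1 : Mat n)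
  map_add' p q := by
    simp only [infinitesimalProduct, Prod.fst_add, Prod.snd_add, Pi.add_apply, add_smul]
    noncomm_ring
  map_smul' c p := by
    simp only [infinitesimalProduct, Prod.smul_fst, Prod.smul_snd, Pi.smul_apply, smul_add,
      smul_sub, smul_mul_assoc, mul_smul_comm, mul_sub, sub_mul, smul_assoc, RingHom.id_apply]

/-- Every linear functional on matrices is a trace form. -/
lemma exists_trace_form (f : Mat n →ₗ[ℂ] ℂ) : ∃ Z : Mat n, ∀ M, f M = (Z * M).trace := by
  refine ⟨Matrix.of fun i j => f (Matrix.single j i 1), fun M => ?_⟩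
  conv_lhs => rw [Matrix.matrix_eq_sum_single M]
  simp only [map_sum, Matrix.trace, Matrix.diag_apply, Matrix.mul_apply, Matrix.of_apply]
  rw [Finset.sum_comm]
  refine Finset.sum_congr rfl fun i _ => Finset.sum_congr rfl fun j _ => ?_
  have : Matrix.single j i (M j i) = M j i • Matrix.single j i (1 : ℂ) := by
    rw [Matrix.smul_single, smul_eq_mul, mul_one]
  rw [this, map_smul, smul_eq_mul, mul_comm]

/-- A matrix orthogonal to all infinitesimal conjugations of `A` commutes with `A`. -/
lemma commute_of_trace_eq_zero {A Z : Mat n} (hA : IsPseudoUnitary A)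
    (h : ∀ X : Mat n, (Z * (X - A * X * adj A)).trace = 0) : A * Z = Z * A := by
  have h1 : Z - adj A * Z * A = 0 := by
    refine Matrix.ext_iff_trace_mul_right.mpr fun X => ?_
    rw [zero_mul, Matrix.trace_zero]
    have h2 := h X
    rw [mul_sub, Matrix.trace_sub] at h2
    rw [sub_mul, Matrix.trace_sub]
    have h3 : (adj A * Z * A * X).trace = (Z * (A * X * adj A)).trace := by
      rw [mul_assoc, mul_assoc, Matrix.trace_mul_comm]
      simp only [mul_assoc]
    rw [h3]
    exact h2
  have h4 : Z = adj A * Z * A := sub_eq_zero.mp h1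
  calc A * Z = A * (adj A * Z * A) := by rw [← h4]
    _ = (A * adj A) * (Z * A) := by simp only [mul_assoc]
    _ = Z * A := by rw [hA.mul_adj_self, one_mul]

lemma conj_of_commute {P Z : Mat n} (hP : IsPseudoUnitary P) (h : P * Z = Z * P) :
    adj P * Z * P = Z := by
  rw [mul_assoc, ← h, ← mul_assoc, hP.adj_mul_self, one_mul]

/-- Schur's lemma for a triple of matrices. -/
lemma exists_eq_smul_of_commute {A : Fin 3 → Mat n}
    (hirr : ∀ W : Submodule ℂ (Vec n), (∀ i, ∀ v ∈ W, A i *ᵥ v ∈ W) → W = ⊥ ∨ W = ⊤)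
    {Z : Mat n} (hZ : ∀ i, A i * Z = Z * A i) : ∃ c : ℂ, Z = c • (1 : Mat n) := by
  obtain ⟨c, hc⟩ := Module.End.exists_eigenvalue (Matrix.toLin' Z)
  refine ⟨c, ?_⟩
  have h := hirr (Module.End.eigenspace (Matrix.toLin' Z) c) fun i v hv => by
    rw [Module.End.mem_eigenspace_iff, Matrix.toLin'_apply] at hv ⊢
    rw [Matrix.mulVec_mulVec, ← hZ i, ← Matrix.mulVec_mulVec, hv, Matrix.mulVec_smul]
  have htop := h.resolve_left hc
  refine Matrix.toLin'.injective (LinearMap.ext fun v => ?_)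
  have hv : v ∈ Module.End.eigenspace (Matrix.toLin' Z) c := htop ▸ Submodule.mem_top
  rw [Module.End.mem_eigenspace_iff.mp hv]
  simp

/-- A trace form vanishing on the range is given by a traceless matrix commuting with all `A i`, and
this is zero by Schur's lemma. -/
lemma infinitesimalMap_surjective {A : Fin 3 → Mat n} (hA : ∀ i, IsPseudoUnitary (A i))
    (hirr : ∀ W : Submodule ℂ (Vec n), (∀ i, ∀ v ∈ W, A i *ᵥ v ∈ W) → W = ⊥ ∨ W = ⊤) :
    Function.Surjective (infinitesimalMap A) := by
  rw [← LinearMap.range_eq_top]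
  by_contra hne
  obtain ⟨f, hf0, hf⟩ := Submodule.exists_le_ker_of_lt_top _ (lt_top_iff_ne_top.mpr hne)
  obtain ⟨Z, hZ⟩ := exists_trace_form f
  have hker : ∀ X t, (Z * (infinitesimalProduct A X + t • (1 : Mat n))).trace = 0 := fun X t => by
    rw [← hZ]
    exact LinearMap.mem_ker.mp (hf ⟨(X, t), rfl⟩)
  have hconj : ∀ P Y : Mat n, (Z * (P * Y * adj P)).trace = (adj P * Z * P * Y).trace := by
    intro P Y
    rw [← mul_assoc, Matrix.trace_mul_comm]
    simp only [mul_assoc]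
  have h0 : A 0 * Z = Z * A 0 := commute_of_trace_eq_zero (hA 0) fun X => by
    simpa [infinitesimalProduct] using hker (Pi.single 0 X) 0
  have h1 : A 1 * Z = Z * A 1 := commute_of_trace_eq_zero (hA 1) fun X => by
    have h := hker (Pi.single 1 X) 0
    simp only [infinitesimalProduct, Pi.single_eq_same, zero_smul, add_zero] at h
    simpa [hconj, conj_of_commute (hA 0) h0] using h
  have h01 : A 0 * A 1 * Z = Z * (A 0 * A 1) := by
    rw [mul_assoc, h1, ← mul_assoc, h0, mul_assoc]
  have h2 : A 2 * Z = Z * A 2 := commute_of_trace_eq_zero (hA 2) fun X => by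
    have h := hker (Pi.single 2 X) 0
    simp only [infinitesimalProduct, Pi.single_eq_same, zero_smul, add_zero] at h
    simpa [hconj, conj_of_commute ((hA 0).mul (hA 1)) h01] using h
  obtain ⟨c, hc⟩ := exists_eq_smul_of_commute hirr (Z := Z) (by
    intro i
    fin_cases i
    exacts [h0, h1, h2])
  have ht : (Z * (infinitesimalProduct A 0 + (1 : ℂ) • (1 : Mat n))).trace = 0 := hker 0 1
  have hc0 : c = 0 := by
    have h3 : infinitesimalProduct A 0 = 0 := by simp [infinitesimalProduct]
    rw [h3, zero_add, one_smul, mul_one, hc, Matrix.trace_smul, Matrix.trace_one] at ht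
    have hcard : ((Fintype.card (Fin n ⊕ Unit) : ℕ) : ℂ) ≠ 0 :=
      Nat.cast_ne_zero.mpr Fintype.card_ne_zero
    exact (mul_eq_zero.mp ht).resolve_right hcard
  apply hf0
  ext1 M
  rw [hZ, hc, hc0]
  simp

/-! ### Openness at irreducible solutions -/

section Openness

open Filter Topology
open scoped Matrix.Norms.Operator

lemma adj_exp (X : Mat n) : adj (NormedSpace.exp X) = NormedSpace.exp (adj X) := by
  have hinv : (gram n)⁻¹ = gram n := Matrix.inv_eq_left_inv gram_mul_gram
  have hunit : IsUnit (gram n) := IsUnit.of_mul_eq_one _ gram_mul_gram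
  have h := Matrix.exp_conj (gram n) Xᴴ hunit
  rw [hinv, Matrix.exp_conjTranspose] at h
  exact h.symm

lemma exp_mul_exp_neg (X : Mat n) : NormedSpace.exp X * NormedSpace.exp (-X) = 1 := by
  rw [← Matrix.exp_add_of_commute X (-X) (Commute.refl X).neg_right, add_neg_cancel,
    NormedSpace.exp_zero]

/-- The exponential of the skew-adjoint matrix `X - adj X`. Using this as a parametrization of the
matrices near the identity which preserve the form lets `X` range over all matrices. -/
noncomputable def skewExp (X : Mat n) : Mat n := NormedSpace.exp (X - adj X)

lemma adj_skewExp (X : Mat n) : adj (skewExp X) = NormedSpace.exp (-(X - adj X)) := by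
  rw [skewExp, adj_exp, adj_sub, adj_adj, neg_sub]

lemma isPseudoUnitary_skewExp (X : Mat n) : IsPseudoUnitary (skewExp X) := by
  rw [IsPseudoUnitary, mul_eq_one_comm, adj_skewExp, skewExp, exp_mul_exp_neg]

/-- The adjoint as a real linear map. -/
noncomputable def adjCLM : Mat n →L[ℝ] Mat n :=
  LinearMap.toContinuousLinearMap
    { toFun := adj
      map_add' := adj_add
      map_smul' := adj_real_smul }

lemma contDiff_adj : ContDiff ℝ 1 (adj : Mat n → Mat n) := (adjCLM (n := n)).contDiff

lemma contDiff_skewExp : ContDiff ℝ 1 (skewExp : Mat n → Mat n) := by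
  have h1 : ContDiff ℝ 1 (NormedSpace.exp : Mat n → Mat n) :=
    contDiff_iff_contDiffAt.mpr fun x => (NormedSpace.exp_analytic (𝕂 := ℝ) x).contDiffAt
  exact h1.comp (contDiff_id.sub contDiff_adj)

/-- The scalar matrix `c e^{is}`. -/
noncomputable def phaseMatrix (c : ℂ) (s : ℝ) : Mat n :=
  Matrix.diagonal fun _ => c * Complex.exp (Complex.I * (s : ℂ))

lemma phaseMatrix_eq (c : ℂ) (s : ℝ) :
    (phaseMatrix c s : Mat n) = (c * Complex.exp (Complex.I * (s : ℂ))) • (1 : Mat n) := by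
  rw [Matrix.smul_one_eq_diagonal, phaseMatrix]

lemma isPseudoUnitary_phaseMatrix {c : ℂ} (hc : star c * c = 1) (s : ℝ) :
    IsPseudoUnitary (phaseMatrix c s : Mat n) := by
  refine isPseudoUnitary_diagonal fun _ => ?_
  have h : star (Complex.exp (Complex.I * (s : ℂ))) * Complex.exp (Complex.I * (s : ℂ)) = 1 := by
    simp [← Complex.exp_conj, ← Complex.exp_add]
  rw [star_mul']
  linear_combination hc + star c * c * h

/-- The real linear map sending a diagonal to the diagonal matrix. -/
noncomputable def diagonalCLM : (Fin n ⊕ Unit → ℂ) →L[ℝ] Mat n :=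
  LinearMap.toContinuousLinearMap (Matrix.diagonalLinearMap (Fin n ⊕ Unit) ℝ ℂ)

lemma contDiff_phaseMatrix (c : ℂ) : ContDiff ℝ 1 (phaseMatrix c : ℝ → Mat n) := by
  have h : ContDiff ℝ 1 fun (s : ℝ) (_ : Fin n ⊕ Unit) =>
      c * Complex.exp (Complex.I * (s : ℂ)) := by
    rw [contDiff_pi]
    exact fun _ => contDiff_const.mul (contDiff_cexp_mul_ofReal contDiff_id _)
  exact (diagonalCLM (n := n)).contDiff.comp h

lemma hasDerivAt_phaseMatrix (c : ℂ) (b : ℝ) :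
    HasDerivAt (fun r : ℝ => (phaseMatrix c (r * b) : Mat n))
      ((c * (Complex.I * b)) • (1 : Mat n)) 0 := by
  have h0 : HasDerivAt (fun r : ℝ => Complex.I * ((r * b : ℝ) : ℂ)) (Complex.I * b) 0 := by
    have h1 : HasDerivAt (fun r : ℝ => r * b) b 0 := by
      simpa using (hasDerivAt_id (0 : ℝ)).mul_const b
    exact h1.ofReal_comp.const_mul _
  have h1 : HasDerivAt (fun (r : ℝ) (_ : Fin n ⊕ Unit) =>
      c * Complex.exp (Complex.I * ((r * b : ℝ) : ℂ))) (fun _ => c * (Complex.I * b)) 0 := by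
    rw [hasDerivAt_pi]
    intro _
    simpa using h0.cexp.const_mul c
  have h2 := (diagonalCLM (n := n)).hasFDerivAt.comp_hasDerivAt (0 : ℝ) h1
  have e : (c * (Complex.I * b)) • (1 : Mat n) = diagonalCLM fun _ => c * (Complex.I * b) :=
    Matrix.smul_one_eq_diagonal _
  rw [e]
  exact h2

/-- The space of deformation parameters: three infinitesimal conjugations, an angle, and a matrix
which spans the self-adjoint directions transverse to the Lie algebra of `U(n,1)`. -/
abbrev Deformation (n : ℕ) : Type := (Fin 3 → Mat n) × ℝ × Mat n

/-- The product of the three elliptic matrices with angles `τ`, after deforming the conjugating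
matrices `Q`, divided by `u` and rotated by the angle `p.2.1`. -/
noncomputable def deformedProduct (u : ℂ) (Q : Fin 3 → Mat n) (τ : Fin 3 → Fin n → ℝ)
    (p : Deformation n) : Mat n :=
  phaseMatrix (star u) p.2.1 * (conjStandard (skewExp (p.1 0) * Q 0) (τ 0) *
    conjStandard (skewExp (p.1 1) * Q 1) (τ 1) * conjStandard (skewExp (p.1 2) * Q 2) (τ 2))

/-- The skew-adjoint part of the deformed product, completed by a self-adjoint matrix. It vanishes
only if both parts do. -/
noncomputable def deformationMap (u : ℂ) (Q : Fin 3 → Mat n)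
    (x : (Fin 3 → Fin n → ℝ) × Deformation n) : (Fin 3 → Fin n → ℝ) × Mat n :=
  (x.1, deformedProduct u Q x.1 x.2 - adj (deformedProduct u Q x.1 x.2) +
    (x.2.2.2 + adj x.2.2.2))

lemma contDiff_deformedProduct (u : ℂ) (Q : Fin 3 → Mat n) :
    ContDiff ℝ 1 fun x : (Fin 3 → Fin n → ℝ) × Deformation n =>
      deformedProduct u Q x.1 x.2 := by
  have hK : ∀ i, ContDiff ℝ 1 fun x : (Fin 3 → Fin n → ℝ) × Deformation n =>
      conjStandard (skewExp (x.2.1 i) * Q i) (x.1 i) := by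
    intro i
    have h1 : ContDiff ℝ 1 fun x : (Fin 3 → Fin n → ℝ) × Deformation n => x.2.1 i := by fun_prop
    have h2 : ContDiff ℝ 1 fun x : (Fin 3 → Fin n → ℝ) × Deformation n => x.1 i := by fun_prop
    have h3 := (contDiff_skewExp.comp h1).mul (contDiff_const (c := Q i))
    exact (h3.mul (contDiff_standardMatrix.comp h2)).mul (contDiff_adj.comp h3)
  have h1 : ContDiff ℝ 1 fun x : (Fin 3 → Fin n → ℝ) × Deformation n => x.2.2.1 := by fun_prop
  exact ((contDiff_phaseMatrix (star u)).comp h1).mul (((hK 0).mul (hK 1)).mul (hK 2))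

lemma contDiff_deformationMap (u : ℂ) (Q : Fin 3 → Mat n) :
    ContDiff ℝ 1 (deformationMap u Q) := by
  have h := contDiff_deformedProduct u Q
  have h1 : ContDiff ℝ 1 fun x : (Fin 3 → Fin n → ℝ) × Deformation n => x.2.2.2 := by fun_prop
  exact contDiff_fst.prodMk ((h.sub (contDiff_adj.comp h)).add (h1.add (contDiff_adj.comp h1)))

lemma hasDerivAt_conjStandard (X Q : Mat n) (α : Fin n → ℝ) :
    HasDerivAt (fun r : ℝ => conjStandard (skewExp (r • X) * Q) α)
      ((X - adj X) * conjStandard Q α - conjStandard Q α * (X - adj X)) 0 := by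
  have h1 : (fun r : ℝ => conjStandard (skewExp (r • X) * Q) α) = fun r : ℝ =>
      NormedSpace.exp (r • (X - adj X)) * conjStandard Q α *
        NormedSpace.exp (r • (-(X - adj X))) := by
    funext r
    rw [conjStandard, adj_mul, adj_skewExp, skewExp, adj_real_smul, ← smul_sub, ← smul_neg,
      conjStandard]
    simp only [mul_assoc]
  rw [h1]
  have h2 := ((hasDerivAt_exp_smul_const (𝕂 := ℝ) (X - adj X) (0 : ℝ)).mul_const
    (conjStandard Q α)).mul (hasDerivAt_exp_smul_const (𝕂 := ℝ) (-(X - adj X)) (0 : ℝ))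
  refine h2.congr_deriv ?_
  simp only [zero_smul, NormedSpace.exp_zero, one_mul, mul_one, mul_neg, sub_eq_add_neg]

lemma deformedProduct_zero {u : ℂ} {τ : Fin 3 → Fin n → ℝ} {Q : Fin 3 → Mat n}
    (h : Solves u τ Q) : deformedProduct u Q τ 0 = 1 := by
  have h0 : skewExp (0 : Mat n) = 1 := by simp [skewExp, NormedSpace.exp_zero]
  have h1 := h.star_mul_self_eq_one
  simp only [deformedProduct, Prod.fst_zero, Prod.snd_zero, Pi.zero_apply, h0, one_mul, h.2,
    phaseMatrix_eq, Complex.ofReal_zero, mul_zero, Complex.exp_zero, mul_one]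
  rw [smul_mul_smul_comm, h1, one_mul, one_smul]

/-- At a solution the velocity of the deformed product is given by the infinitesimal conjugations
and the infinitesimal rotation. -/
lemma hasDerivAt_deformedProduct {u : ℂ} {τ : Fin 3 → Fin n → ℝ} {Q : Fin 3 → Mat n}
    (h : Solves u τ Q) (p : Deformation n) :
    HasDerivAt (fun r : ℝ => deformedProduct u Q τ (r • p))
      (infinitesimalProduct (fun i => conjStandard (Q i) (τ i)) (fun i => p.1 i - adj (p.1 i)) +
        (Complex.I * p.2.1) • (1 : Mat n)) 0 := by
  have hu := h.star_mul_self_eq_one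
  have h0 : skewExp (0 : Mat n) = 1 := by simp [skewExp, NormedSpace.exp_zero]
  have hK := fun i => hasDerivAt_conjStandard (p.1 i) (Q i) (τ i)
  have hd := (hasDerivAt_phaseMatrix (n := n) (star u) p.2.1).mul (((hK 0).mul (hK 1)).mul (hK 2))
  refine hd.congr_deriv ?_
  have hA := fun i => (h.1 i).conjStandard (τ i)
  have hprod := h.2
  have hC : conjStandard (Q 2) (τ 2) =
      u • (adj (conjStandard (Q 1) (τ 1)) * adj (conjStandard (Q 0) (τ 0))) := by
    have h3 := congrArg (adj (conjStandard (Q 0) (τ 0) * conjStandard (Q 1) (τ 1)) * ·) hprod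
    simp only [← mul_assoc] at h3
    rw [mul_assoc (adj _), ((hA 0).mul (hA 1)).adj_mul_self, one_mul, mul_smul_comm, mul_one,
      adj_mul] at h3
    exact h3
  have hu' : u * star u = 1 := by rw [mul_comm, hu]
  simp only [Pi.mul_apply, zero_smul, h0, one_mul, zero_mul, phaseMatrix_eq, Complex.ofReal_zero,
    mul_zero, Complex.exp_zero, mul_one, infinitesimalProduct]
  rw [hC]
  have hAA := (hA 0).mul_adj_self
  have hBB := (hA 1).mul_adj_self
  generalize conjStandard (Q 0) (τ 0) = A at *
  generalize conjStandard (Q 1) (τ 1) = B at *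
  have hA1 : ∀ Y : Mat n, A * (adj A * Y) = Y := fun Y => by rw [← mul_assoc, hAA, one_mul]
  have hB1 : ∀ Y : Mat n, B * (adj B * Y) = Y := fun Y => by rw [← mul_assoc, hBB, one_mul]
  simp only [adj_smul, adj_mul, adj_adj, mul_sub, sub_mul, mul_add, add_mul, smul_mul_assoc,
    mul_smul_comm, mul_assoc, smul_sub, smul_add, smul_smul, hu, hu', hA1, hB1, hAA, one_mul,
    mul_one, one_smul]
  rw [← mul_assoc u, hu', one_mul]
  abel

lemma hasDerivAt_smul_vector {E : Type*} [NormedAddCommGroup E] [NormedSpace ℝ E] (v : E) :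
    HasDerivAt (fun r : ℝ => r • v) v 0 := by
  simpa using (hasDerivAt_id (0 : ℝ)).smul_const v

lemma hasDerivAt_deformationMap {u : ℂ} {τ : Fin 3 → Fin n → ℝ} {Q : Fin 3 → Mat n}
    (h : Solves u τ Q) (p : Deformation n) {D : Mat n}
    (hD : infinitesimalProduct (fun i => conjStandard (Q i) (τ i)) (fun i => p.1 i - adj (p.1 i)) +
        (Complex.I * p.2.1) • (1 : Mat n) = D) :
    HasDerivAt (fun r : ℝ => deformationMap u Q (τ, r • p))
      (0, D - adj D + (p.2.2 + adj p.2.2)) 0 := by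
  have hg := hasDerivAt_deformedProduct h p
  rw [hD] at hg
  have hadj := (adjCLM (n := n)).hasFDerivAt.comp_hasDerivAt (0 : ℝ) hg
  have hW : HasDerivAt (fun r : ℝ => r • (p.2.2 + adj p.2.2)) (p.2.2 + adj p.2.2) 0 :=
    hasDerivAt_smul_vector _
  have hW' : (fun r : ℝ => r • (p.2.2 + adj p.2.2)) =
      fun r : ℝ => (r • p).2.2 + adj (r • p).2.2 := by
    funext r
    simp only [Prod.smul_snd, adj_real_smul, smul_add]
  rw [hW'] at hW
  exact (hasDerivAt_const (0 : ℝ) τ).prodMk ((hg.sub hadj).add hW)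

/-- In the deformation, every matrix is a velocity: its skew-adjoint part comes from the
conjugations and the rotation, its self-adjoint part from the auxiliary matrix. -/
lemma exists_deformation_velocity {A : Fin 3 → Mat n}
    (hsurj : Function.Surjective (infinitesimalMap A)) (M : Mat n) :
    ∃ (p : Deformation n) (D : Mat n),
      infinitesimalProduct A (fun i => p.1 i - adj (p.1 i)) +
        (Complex.I * p.2.1) • (1 : Mat n) = D ∧ D - adj D + (p.2.2 + adj p.2.2) = M := by
  obtain ⟨⟨X, t⟩, ht⟩ := hsurj ((1 / 4 : ℝ) • M)
  have ht' : infinitesimalProduct A X + t • (1 : Mat n) = (1 / 4 : ℝ) • M := ht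
  -- the skew-adjoint part is taken twice: in the parametrization and in `deformationMap`
  refine ⟨(X, 2 * t.im, (1 / 2 : ℝ) • M), (1 / 4 : ℝ) • M - adj ((1 / 4 : ℝ) • M), ?_, ?_⟩
  · have h1 := infinitesimalProduct_sub A X (fun i => adj (X i))
    have h2 : infinitesimalProduct A (fun i => X i - adj (X i)) =
        infinitesimalProduct A X - adj (infinitesimalProduct A X) := by
      rw [adj_infinitesimalProduct, ← h1]
      rfl
    have h3 : Complex.I * ((2 * t.im : ℝ) : ℂ) = t - star t := by
      apply Complex.ext <;> simp
      ring
    rw [← ht', adj_add, adj_smul, adj_one]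
    simp only [h2, h3, sub_smul]
    abel
  · simp only [adj_sub, adj_adj, adj_real_smul]
    module

lemma map_nhds_eq_of_range_eq_top {E F : Type*} [NormedAddCommGroup E] [NormedSpace ℝ E]
    [NormedAddCommGroup F] [NormedSpace ℝ F] (_ : FiniteDimensional ℝ E)
    (_ : FiniteDimensional ℝ F) {f : E → F} {f' : E →L[ℝ] F} {a : E}
    (hf : HasStrictFDerivAt f f' a) (h : f'.range = ⊤) :
    map f (𝓝 a) = 𝓝 (f a) := by
  have : CompleteSpace E := FiniteDimensional.complete ℝ E
  have : CompleteSpace F := FiniteDimensional.complete ℝ F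
  exact hf.map_nhds_eq_of_surj h

/-- The deformation map is locally surjective at a solution. As it preserves the angles, it has
zeros over all nearby angles. -/
lemma map_nhds_deformationMap {u : ℂ} {τ : Fin 3 → Fin n → ℝ} {Q : Fin 3 → Mat n}
    (h : Solves u τ Q)
    (hsurj : Function.Surjective (infinitesimalMap fun i => conjStandard (Q i) (τ i))) :
    map (deformationMap u Q) (𝓝 (τ, 0)) = 𝓝 (τ, 0) := by
  have hstrict : HasStrictFDerivAt (deformationMap u Q)
      (fderiv ℝ (deformationMap u Q) (τ, 0)) (τ, 0) :=
    (contDiff_deformationMap u Q).contDiffAt.hasStrictFDerivAt one_ne_zero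
  set H' := fderiv ℝ (deformationMap u Q) (τ, 0) with hH'
  have hfd : HasFDerivAt (deformationMap u Q) H' (τ, 0) := hstrict.hasFDerivAt
  have hfst : ∀ x, (H' x).1 = x.1 := by
    intro x
    have h1 : HasFDerivAt (fun x : (Fin 3 → Fin n → ℝ) × Deformation n => x.1)
      ((ContinuousLinearMap.fst ℝ _ _).comp H') (τ, 0) := hfd.fst
    have h2 := h1.unique hasFDerivAt_fst
    exact congrArg (fun f => f x) h2
  have hsnd : ∀ (p : Deformation n) (D : Mat n),
      infinitesimalProduct (fun i => conjStandard (Q i) (τ i)) (fun i => p.1 i - adj (p.1 i)) +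
        (Complex.I * p.2.1) • (1 : Mat n) = D →
      H' (0, p) = (0, D - adj D + (p.2.2 + adj p.2.2)) := by
    intro p D hD
    have h1 : HasDerivAt (fun r : ℝ => deformationMap u Q ((τ, 0) + r • (0, p))) (H' (0, p)) 0 :=
      hfd.hasLineDerivAt (0, p)
    have h2 : ∀ r : ℝ, ((τ, 0) + r • (0, p) : (Fin 3 → Fin n → ℝ) × Deformation n) =
        (τ, r • p) := fun r => by simp
    simp only [h2] at h1
    exact h1.unique (hasDerivAt_deformationMap h p hD)
  have hrange : H'.range = ⊤ := by
    rw [LinearMap.range_eq_top]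
    rintro ⟨v, M⟩
    obtain ⟨p, D, hD, hM⟩ := exists_deformation_velocity hsurj (M - (H' (v, 0)).2)
    refine ⟨(v, p), ?_⟩
    have h1 : ((v, p) : (Fin 3 → Fin n → ℝ) × Deformation n) = (v, 0) + (0, p) := by simp
    have h2 := hsnd p D hD
    rw [hM] at h2
    have h3 : H' (v, p) = (v, M) := by
      rw [h1, map_add, h2]
      ext1
      · simp [hfst]
      · simp
    exact h3
  have hbase : deformationMap u Q (τ, 0) = (τ, 0) := by
    simp [deformationMap, deformedProduct_zero h]
  have hE : FiniteDimensional ℝ ((Fin 3 → Fin n → ℝ) × Deformation n) := inferInstance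
  have hF : FiniteDimensional ℝ ((Fin 3 → Fin n → ℝ) × Mat n) := inferInstance
  have := map_nhds_eq_of_range_eq_top hE hF hstrict hrange
  rwa [hbase] at this

/-- A matrix preserving the form which is self-adjoint is an involution; close to the identity,
it is the identity. -/
lemma IsPseudoUnitary.eq_one_of_self_adj {g : Mat n} (hg : IsPseudoUnitary g)
    (hadj : EllipticHorn.adj g = g)
    (hdet : (g + 1).det ≠ 0) : g = 1 := by
  have h1 : (g - 1) * (g + 1) = 0 := by
    have h2 := hg.adj_mul_self
    rw [hadj] at h2
    rw [sub_mul, mul_add, h2, mul_one, one_mul, add_comm, sub_self]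
  have hunit : IsUnit (g + 1) := (Matrix.isUnit_iff_isUnit_det _).mpr (isUnit_iff_ne_zero.mpr hdet)
  exact sub_eq_zero.mp (hunit.mul_left_eq_zero.mp h1)

/-- An irreducible solution persists for all nearby angles. -/
lemma Solves.eventually_exists {u : ℂ} (hun : u ^ (n + 1) = 1) {τ : Fin 3 → Fin n → ℝ}
    {Q : Fin 3 → Mat n} (h : Solves u τ Q)
    (hirr : ∀ W : Submodule ℂ (Vec n),
      (∀ i, ∀ v ∈ W, conjStandard (Q i) (τ i) *ᵥ v ∈ W) → W = ⊥ ∨ W = ⊤) :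
    ∀ᶠ σ in 𝓝 τ, ∃ P, Solves u σ P := by
  have hu := h.star_mul_self_eq_one
  have hmap := map_nhds_deformationMap h
    (infinitesimalMap_surjective (fun i => (h.1 i).conjStandard (τ i)) hirr)
  have hdet : ∀ᶠ x : (Fin 3 → Fin n → ℝ) × Deformation n in 𝓝 (τ, 0),
      (deformedProduct u Q x.1 x.2 + 1).det ≠ 0 := by
    have hc : Continuous fun x : (Fin 3 → Fin n → ℝ) × Deformation n =>
        (deformedProduct u Q x.1 x.2 + 1).det :=
      Continuous.matrix_det ((contDiff_deformedProduct u Q).continuous.add continuous_const)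
    refine hc.continuousAt.eventually_ne ?_
    rw [deformedProduct_zero h]
    have h2 : (1 + 1 : Mat n) = (2 : ℂ) • 1 := (two_smul ℂ (1 : Mat n)).symm
    rw [h2, Matrix.det_smul, Matrix.det_one, mul_one]
    exact pow_ne_zero _ two_ne_zero
  have hsmall : ∀ᶠ x : (Fin 3 → Fin n → ℝ) × Deformation n in 𝓝 (τ, 0),
      |(n + 1) * x.2.2.1| < 2 * Real.pi := by
    have hc : Continuous fun x : (Fin 3 → Fin n → ℝ) × Deformation n =>
        |((n : ℝ) + 1) * x.2.2.1| := by fun_prop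
    refine hc.continuousAt.eventually_lt_const ?_
    simpa using Real.pi_pos
  have himage := image_mem_map (m := deformationMap u Q) (hdet.and hsmall)
  rw [hmap] at himage
  have hsection : Tendsto (fun σ : Fin 3 → Fin n → ℝ => (σ, (0 : Mat n))) (𝓝 τ) (𝓝 (τ, 0)) :=
    (Continuous.prodMk_left (0 : Mat n)).tendsto τ
  filter_upwards [hsection himage] with σ hσ
  obtain ⟨⟨σ', p⟩, ⟨hp1, hp2⟩, hp⟩ := hσ
  obtain ⟨rfl, hp0⟩ := Prod.mk.inj hp
  simp only at hp1 hp2 hp0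
  have hK : ∀ i, IsPseudoUnitary (skewExp (p.1 i) * Q i) := fun i =>
    (isPseudoUnitary_skewExp _).mul (h.1 i)
  have hKS := fun i => (hK i).conjStandard (σ' i)
  set g := deformedProduct u Q σ' p with hg
  have hgu : IsPseudoUnitary g := (isPseudoUnitary_phaseMatrix (by rw [star_star, mul_comm, hu])
    _).mul (((hKS 0).mul (hKS 1)).mul (hKS 2))
  -- the self-adjoint and skew-adjoint parts vanish separately
  have hself : adj g = g := by
    have h1 := congrArg adj hp0
    simp only [adj_add, adj_sub, adj_adj, adj_zero] at h1
    have h2 : (2 : ℂ) • (g - adj g) = 0 := by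
      rw [two_smul]
      calc g - adj g + (g - adj g) = (g - adj g + (p.2.2 + adj p.2.2)) -
            (adj g - g + (adj p.2.2 + p.2.2)) := by abel
        _ = 0 := by rw [hp0, h1, sub_zero]
    exact (sub_eq_zero.mp ((smul_eq_zero.mp h2).resolve_left two_ne_zero)).symm
  have hg1 : g = 1 := hgu.eq_one_of_self_adj hself hp1
  rw [hg, deformedProduct, phaseMatrix_eq, smul_mul_assoc, one_mul] at hg1
  -- the determinant shows that the angle of rotation is zero
  have hs : p.2.1 = 0 := by
    have h1 := congrArg Matrix.det hg1
    rw [Matrix.det_smul, Matrix.det_mul, Matrix.det_mul, (hK 0).det_conjStandard,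
      (hK 1).det_conjStandard, (hK 2).det_conjStandard, Matrix.det_one, mul_one, mul_one, mul_one,
      mul_pow] at h1
    simp only [Fintype.card_sum, Fintype.card_fin, Fintype.card_unit] at h1
    rw [← star_pow, hun, star_one, one_mul, ← Complex.exp_nat_mul] at h1
    obtain ⟨m, hm⟩ := Complex.exp_eq_one_iff.mp h1
    have h2 : ((n : ℝ) + 1) * p.2.1 = m * (2 * Real.pi) := by
      have h3 : Complex.I * ((((n : ℝ) + 1) * p.2.1 : ℝ) : ℂ)
          = Complex.I * ((m * (2 * Real.pi) : ℝ) : ℂ) := by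
        push_cast at hm ⊢
        linear_combination hm
      exact_mod_cast mul_left_cancel₀ Complex.I_ne_zero h3
    rw [h2, abs_mul, abs_of_pos Real.two_pi_pos] at hp2
    have h4 : |(m : ℝ)| < 1 := by
      by_contra h5
      nlinarith [Real.pi_pos]
    have h5 : m = 0 := by
      have : |m| < 1 := by exact_mod_cast h4
      exact Int.abs_lt_one_iff.mp this
    rw [h5, Int.cast_zero, zero_mul] at h2
    exact (mul_eq_zero.mp h2).resolve_left (by positivity)
  refine ⟨fun i => skewExp (p.1 i) * Q i, hK, ?_⟩
  rw [hs, Complex.ofReal_zero, mul_zero, Complex.exp_zero, mul_one] at hg1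
  have h1 := congrArg (u • ·) hg1
  simp only [smul_smul] at h1
  rw [mul_comm u, hu, one_smul] at h1
  exact h1

end Openness

/-! ### Cells -/

open scoped Topology in
/-- Relative to the space of all angles, the solution set is a neighborhood of each of its points
that is not in the reducible set. -/
lemma eventually_mem_solutionSet {u : ℂ} (hun : u ^ (n + 1) = 1) {τ : Fin 3 → Fin n → ℝ}
    (hτ : τ ∈ solutionSet n u) (hred : τ ∉ reducibleSet n u) :
    ∀ᶠ σ in 𝓝 τ, (∀ i, σ i ∈ angleSpace n) → σ ∈ solutionSet n u := by
  obtain ⟨hang, Q, hQ⟩ := mem_solutionSet_iff.mp hτ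
  filter_upwards [hQ.eventually_exists hun (hQ.eq_bot_or_eq_top hang hred)] with σ hσ hσ'
  exact mem_solutionSet_iff.mpr ⟨hσ', hσ⟩

/-- On a connected set of nonzero angles off the reducible set, the solution set is clopen. -/
lemma preconnected_subset_or_disjoint {u : ℂ} (hun : u ^ (n + 1) = 1)
    {C : Set (Fin 3 → Fin n → ℝ)} (hC : IsPreconnected C)
    (hsub : C ⊆ nonzeroAngleTriples n \ reducibleSet n u) :
    C ⊆ solutionSet n u ∨ C ⊆ (solutionSet n u)ᶜ := by
  by_contra hne
  push Not at hne
  obtain ⟨h1, h2⟩ := hne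
  obtain ⟨σ, hσ, hσ'⟩ := Set.not_subset.mp h1
  obtain ⟨τ, hτ, hτ'⟩ := Set.not_subset.mp h2
  rw [Set.notMem_compl_iff] at hτ'
  set O : Set (Fin 3 → Fin n → ℝ) :=
    interior {σ | (∀ i, σ i ∈ angleSpace n) → σ ∈ solutionSet n u} with hO
  have hcover : C ⊆ O ∪ (closure (solutionSet n u))ᶜ := fun ξ hξ => by
    by_cases h : ξ ∈ solutionSet n u
    · exact Or.inl (mem_interior_iff_mem_nhds.mpr (eventually_mem_solutionSet hun h (hsub hξ).2))
    · exact Or.inr fun h' => h (mem_solutionSet_of_mem_closure (hsub hξ).1 h')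
  have hτO : τ ∈ O := mem_interior_iff_mem_nhds.mpr (eventually_mem_solutionSet hun hτ' (hsub hτ).2)
  have hσc : σ ∈ (closure (solutionSet n u))ᶜ := fun h' =>
    hσ' (mem_solutionSet_of_mem_closure (hsub hσ).1 h')
  obtain ⟨ξ, hξ, hξO, hξc⟩ := hC O (closure (solutionSet n u))ᶜ isOpen_interior
    isClosed_closure.isOpen_compl hcover ⟨τ, hτ, hτO⟩ ⟨σ, hσ, hσc⟩
  exact hξc (subset_closure (interior_subset hξO fun i => ((hsub hξ).1 i).1))

end EllipticHorn

theorem theorem3p9 (n : ℕ) (hn : 1 ≤ n) (u : ℂ) (hu : u ^ (n + 1) = 1)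
    (C : Set (Fin 3 → Fin n → ℝ)) (hC : EllipticHorn.IsCell n u C) :
    C ⊆ EllipticHorn.solutionSet n u ∨ C ⊆ (EllipticHorn.solutionSet n u)ᶜ := by
  obtain ⟨τ, -, rfl⟩ := hC
  exact EllipticHorn.preconnected_subset_or_disjoint hu isPreconnected_connectedComponentIn
    (connectedComponentIn_subset _ _)
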